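/- Let $\varphi(z)=\int_{[0,\infty)}e^{-zu}\,d\nu(u)$, $\operatorname{Re}z\ge 0$, be the Laplace transform of a probability measure $\nu$ on $[0,\infty)$. A characteristic function (of a probability law on $\mathbb R$) $\omega$ is called stable if for every integer $n\ge 1$ there are $c_n>0$ and $d_n\in\mathbb R$ with $\omega(t)^n=\omega(c_nt)\,e^{id_nt}$ for all $t\in\mathbb R$, and strictly stable if this holds with $d_n=0$ for every $n$ (degenerate laws are included). A characteristic function $f$ is called $\varphi$-stable (respectively $\varphi$-strictly stable) if $f(t)=\varphi\{-\log\omega(t)\}$ for all $t\in\mathbb R$, for some stable (respectively strictly stable) characteristic function $\omega$, where $\log\omega$ is the continuous branch of the logarithm with $\log\omega(0)=0$. Let $f$ be a characteristic function. (1) $f$ is $\varphi$-stable if and only if there are real constants $a_n>0$ and $\mu_n$ and a characteristic function $h$ such that $$f(t)=\lim_{n\to\infty}\varphi\{n(1-h(t/a_n))+it\mu_n\}\qquad\text{for all }t\in\mathbb R.$$ (2) $f$ is $\varphi$-strictly stable if and only if such a representation exists with $\mu_n=0$ for all $n$, that is, if and only if there are constants $a_n>0$ and a characteristic function $h$ such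 that $$f(t)=\lim_{n\to\infty}\varphi\{n(1-h(t/a_n))\}\qquad\text{for all }t\in\mathbb R.$$ -/

import Mathlib

open MeasureTheory Filter Topology

/-- `f : ℝ → ℂ` is the characteristic function of a probability law on the line. -/
def IsCharFun (f : ℝ → ℂ) : Prop :=
  ∃ P : Measure ℝ, IsProbabilityMeasure P ∧ ∀ t : ℝ, f t = charFun P t

/-- The Laplace transform `φ(z) = ∫ exp(-z u) dν(u)`. For a probability measure `ν` carried by
`[0, ∞)` the integral converges absolutely on the closed half-plane `0 ≤ Re z`. -/
noncomputable def laplaceTransform (ν : Measure ℝ) (z : ℂ) : ℂ :=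
  ∫ u : ℝ, Complex.exp (-(z * (u : ℂ))) ∂ν

/-- A stable characteristic function (degenerate laws are included): for every `n ≥ 1`, the sum of
`n` independent copies has the same type as one copy. -/
def IsStableCharFun (ω : ℝ → ℂ) : Prop :=
  IsCharFun ω ∧ ∀ n : ℕ, 1 ≤ n → ∃ c : ℝ, 0 < c ∧ ∃ d : ℝ, ∀ t : ℝ,
    ω t ^ n = ω (c * t) * Complex.exp (Complex.I * (d : ℂ) * (t : ℂ))

/-- A strictly stable characteristic function: stable, with no centering needed. -/
def IsStrictlyStableCharFun (ω : ℝ → ℂ) : Prop :=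
  IsCharFun ω ∧ ∀ n : ℕ, 1 ≤ n → ∃ c : ℝ, 0 < c ∧ ∀ t : ℝ, ω t ^ n = ω (c * t)

/-- `ψ = -log ω`, where `log` is the continuous branch of the logarithm along `ω`
that vanishes at `0`. -/
def IsNegLog (ψ ω : ℝ → ℂ) : Prop :=
  Continuous ψ ∧ ψ 0 = 0 ∧ ∀ t : ℝ, Complex.exp (-ψ t) = ω t

/-- `f` is `φ`-stable: `f = φ(-log ω)` for a stable characteristic function `ω`. -/
def IsPhiStable (φ : ℂ → ℂ) (f : ℝ → ℂ) : Prop :=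
  ∃ ω ψ : ℝ → ℂ, IsStableCharFun ω ∧ IsNegLog ψ ω ∧ ∀ t : ℝ, f t = φ (ψ t)

/-- `f` is `φ`-strictly stable: `f = φ(-log ω)` for a strictly stable characteristic
function `ω`. -/
def IsPhiStrictlyStable (φ : ℂ → ℂ) (f : ℝ → ℂ) : Prop :=
  ∃ ω ψ : ℝ → ℂ, IsStrictlyStableCharFun ω ∧ IsNegLog ψ ω ∧ ∀ t : ℝ, f t = φ (ψ t)

/-! From stability to a limit: an exponent `ψ = -log ω` with `n ψ(t/a_n) = ψ(t)` gives `n (1 -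
exp(-ψ(t/a_n))) → ψ(t)`, and `φ` is continuous on the closed half-plane. When centring is needed,
`ω` is first shifted so that the quadratic error `n |ψ₀(t/a_n)|²` still vanishes. Growth is
controlled along powers of two (`norm_comp_div_pow_le`), and the real part of `ψ` compares a general
norming with these.

From a limit to stability: put `ψ_n(t) = n (1 - h(t/a_n)) + i t μ_n`. The main obstacle is that `φ`
need not be injective on the half-plane, so convergence of `φ(ψ_n)` does not at once give
convergence of `ψ_n`. Each `ψ_n` is the exponent of a Lévy process, and `φ(ψ_n)` is the
characteristic function of that process sampled at an independent time with law `ν`. Convergence of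
the sampled laws makes the `ψ_n` equicontinuous at `0`
(`exists_forall_norm_le_of_tendsto_laplaceTransform`). The increment inequality spreads this over
the line, so ultrafilter limits exist and are again exponents.

Limits of `ψ_n` and `ψ_{n+1}` along one ultrafilter differ by a scaling `c` and a drift `D`, by
convergence of types. Both yield `f` under `φ`, and rigidity of the sampled process
(`eq_zero_of_laplaceTransform_add_eq`, `eq_I_mul_of_laplaceTransform_eq`) makes them equal unless
`f(t) = φ(i b t)`, a case which is strictly stable outright. So `ψ_{n+1}(t) - ψ_n(t) → 0`. The
cluster points of `ψ_n(t)` lie in a level set of the nonconstant holomorphic `φ`, and vanishing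
steps leave room for only one (`exists_tendsto_of_tendsto_comp`). Hence `ψ_n → Ψ`, and comparing
`ψ_{Nn}` with `ψ_n` shows that `Ψ` is stable, without drift if all `μ_n` vanish. -/

/-! ### Characteristic functions: closure properties, compactness, increments. -/

namespace IsCharFun

variable {f g : ℝ → ℂ}

lemma continuous (hf : IsCharFun f) : Continuous f := by
  obtain ⟨P, hP, h⟩ := hf
  rw [funext h]
  exact continuous_charFun

lemma map_zero (hf : IsCharFun f) : f 0 = 1 := by
  obtain ⟨P, hP, h⟩ := hf
  simp [h]

lemma norm_le_one (hf : IsCharFun f) (t : ℝ) : ‖f t‖ ≤ 1 := by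
  obtain ⟨P, hP, h⟩ := hf
  rw [h]
  exact norm_charFun_le_one t

lemma re_le_one (hf : IsCharFun f) (t : ℝ) : (f t).re ≤ 1 :=
  (Complex.re_le_norm _).trans (hf.norm_le_one t)

lemma comp_mul (hf : IsCharFun f) (a : ℝ) : IsCharFun fun t => f (a * t) := by
  obtain ⟨P, hP, h⟩ := hf
  refine ⟨P.map (a * ·), Measure.isProbabilityMeasure_map (by fun_prop), fun t => ?_⟩
  beta_reduce
  rw [h, charFun_map_mul]

lemma mul (hf : IsCharFun f) (hg : IsCharFun g) : IsCharFun fun t => f t * g t := by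
  obtain ⟨P, hP, h⟩ := hf
  obtain ⟨Q, hQ, h'⟩ := hg
  exact ⟨P.conv Q, inferInstance, fun t => by beta_reduce; rw [h, h', charFun_conv]⟩

lemma exp_I_mul (b : ℝ) : IsCharFun fun t => Complex.exp (Complex.I * b * t) :=
  ⟨Measure.dirac b, inferInstance, fun t => by
    rw [charFun_dirac]
    beta_reduce
    congr 1
    simp
    ring⟩

lemma one : IsCharFun fun _ => 1 := by
  simpa using exp_I_mul 0

lemma pow (hf : IsCharFun f) (n : ℕ) : IsCharFun fun t => f t ^ n := by
  induction n with
  | zero => simpa using one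
  | succ n ih => simpa only [pow_succ] using ih.mul hf

lemma convex_one (hf : IsCharFun f) {p : ℝ} (hp0 : 0 ≤ p) (hp1 : p ≤ 1) :
    IsCharFun fun t => 1 + p * (f t - 1) := by
  obtain ⟨P, hP, h⟩ := hf
  refine ⟨ENNReal.ofReal (1 - p) • Measure.dirac 0 + ENNReal.ofReal p • P, ⟨?_⟩, fun t => ?_⟩
  · simp only [Measure.coe_add, Measure.coe_smul, Pi.add_apply, Pi.smul_apply, measure_univ,
      smul_eq_mul, mul_one]
    rw [← ENNReal.ofReal_add (by linarith) hp0]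
    simp
  · beta_reduce
    rw [charFun_apply_real, integral_add_measure, integral_smul_measure, integral_smul_measure,
      ← charFun_apply_real, ← charFun_apply_real, h, charFun_dirac,
      ENNReal.toReal_ofReal (by linarith), ENNReal.toReal_ofReal hp0]
    · simp
      ring
    all_goals
      refine Integrable.smul_measure ?_ (by simp)
      refine Integrable.of_bound (C := 1) (by fun_prop) (ae_of_all _ fun x => ?_)
      rw [← Complex.ofReal_mul, Complex.norm_exp_ofReal_mul_I]

/-- Characteristic functions that are equicontinuous at `0` have pointwise limits which are
characteristic functions. -/
lemma of_tendsto_ultrafilter {ι : Type*} {U : Ultrafilter ι} {χ : ι → ℝ → ℂ}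
    (hχ : ∀ i, IsCharFun (χ i))
    (heq : ∀ ε > 0, ∃ δ > 0, ∀ i, ∀ t, |t| ≤ δ → ‖1 - χ i t‖ ≤ ε)
    (hlim : ∀ t, Tendsto (fun i => χ i t) U (𝓝 (g t))) : IsCharFun g := by
  choose P hP h using hχ
  let q : ι → ProbabilityMeasure ℝ := fun i => ⟨P i, hP i⟩
  -- The truncation inequality bounds the tails by the mean of `1 - χ i` near `0`; Prokhorov's
  -- theorem then supplies a limit law along the ultrafilter.
  have htight : IsTightMeasureSet {((μ : ProbabilityMeasure ℝ) : Measure ℝ) | μ ∈ Set.range q} := by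
    rw [isTightMeasureSet_iff_exists_isCompact_measure_compl_le]
    intro ε hε
    obtain ⟨e, he0, heε⟩ : ∃ e : ℝ, 0 < e ∧ ENNReal.ofReal (2 * e) ≤ ε := by
      by_cases hT : ε = ⊤
      · exact ⟨1, one_pos, by simp [hT]⟩
      · refine ⟨ε.toReal / 2, half_pos (ENNReal.toReal_pos hε.ne' hT), ?_⟩
        rw [mul_div_cancel₀ _ two_ne_zero, ENNReal.ofReal_toReal hT]
    obtain ⟨δ, hδ, hδe⟩ := heq e he0
    refine ⟨Metric.closedBall 0 (2 / δ), isCompact_closedBall _ _, ?_⟩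
    rintro _ ⟨_, ⟨i, rfl⟩, rfl⟩
    refine le_trans ?_ heε
    have hr : 0 < 2 / δ := by positivity
    have key := measureReal_abs_gt_le_integral_charFun (μ := P i) hr
    have hset : (Metric.closedBall (0 : ℝ) (2 / δ))ᶜ = {x | 2 / δ < |x|} := by
      ext x; simp
    have hδ2 : 2 * (2 / δ)⁻¹ = δ := by field_simp
    have hb : ‖∫ t in (-2 * (2 / δ)⁻¹)..(2 * (2 / δ)⁻¹), 1 - charFun (P i) t‖
        ≤ e * |2 * (2 / δ)⁻¹ - -2 * (2 / δ)⁻¹| := by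
      refine intervalIntegral.norm_integral_le_of_norm_le_const fun t ht => ?_
      rw [neg_mul, hδ2, Set.uIoc_of_le (by linarith)] at ht
      rw [← h]
      exact hδe i t (abs_le.2 ⟨ht.1.le, ht.2⟩)
    rw [hset]
    change P i _ ≤ _
    rw [← ofReal_measureReal]
    refine ENNReal.ofReal_le_ofReal (key.trans ?_)
    rw [neg_mul, hδ2, sub_neg_eq_add, abs_of_pos (by linarith)] at hb
    calc _ ≤ 2⁻¹ * (2 / δ) * (e * (δ + δ)) := by
          rw [neg_mul, hδ2]; gcongr
      _ = 2 * e := by field_simp; ring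
  obtain ⟨Q, -, hQ⟩ := (isCompact_closure_of_isTightMeasureSet htight).ultrafilter_le_nhds
    (U.map q) (.trans (by simp) (monotone_principal subset_closure))
  have hQ' : Tendsto q U (𝓝 Q) := hQ
  rw [ProbabilityMeasure.tendsto_iff_forall_integral_rclike_tendsto ℂ] at hQ'
  refine ⟨Q, inferInstance, fun t => tendsto_nhds_unique (hlim t) ?_⟩
  have := hQ' (BoundedContinuousFunction.innerProbChar t)
  simp_rw [← charFun_eq_integral_innerProbChar] at this
  simp only [h]
  exact this

/-- The increment inequality for characteristic functions. -/
lemma norm_add_sub_sub_sq_le (hf : IsCharFun f) (s t : ℝ) :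
    ‖(1 - f (s + t)) - (1 - f s) - (1 - f t)‖ ^ 2 ≤ 4 * ((1 - f s).re * (1 - f t).re) := by
  obtain ⟨P, hP, h⟩ := hf
  let e : ℝ → ℝ → ℂ := fun t x => Complex.exp (t * x * Complex.I)
  have hne : ∀ t x, ‖e t x‖ = 1 := fun t x => by
    simp only [e]
    rw [← Complex.ofReal_mul, Complex.norm_exp_ofReal_mul_I]
  have hec : ∀ t, Continuous (e t) := fun t => by fun_prop
  have hint : ∀ t, Integrable (e t) P := fun t =>
    Integrable.of_bound (hec t).aestronglyMeasurable 1 (ae_of_all _ fun x => (hne t x).le)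
  have hfe : ∀ t, f t = ∫ x, e t x ∂P := fun t => by rw [h, charFun_apply_real]
  have hadd : ∀ x, e (s + t) x = e s x * e t x := fun x => by
    simp only [e]
    rw [← Complex.exp_add]
    congr 1
    push_cast
    ring
  have hbd : ∀ t x, ‖1 - e t x‖ ≤ 2 := fun t x =>
    (norm_sub_le _ _).trans (by rw [hne, norm_one]; norm_num)
  have hsq : ∀ t, ∫ x, ‖1 - e t x‖ ^ 2 ∂P = 2 * (1 - f t).re := fun t => by
    have : ∀ x, ‖1 - e t x‖ ^ 2 = 2 * (1 - e t x).re := fun x => by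
      have h1 := hne t x
      rw [← sq_eq_sq₀ (by positivity) (by positivity), ← Complex.normSq_eq_norm_sq,
        Complex.normSq_apply] at h1
      rw [← Complex.normSq_eq_norm_sq, Complex.normSq_apply]
      simp only [Complex.sub_re, Complex.one_re, Complex.sub_im, Complex.one_im]
      nlinarith
    simp_rw [this]
    rw [integral_const_mul]
    congr 1
    rw [hfe]
    have h2 := integral_re (𝕜 := ℂ) (μ := P) (f := fun x => 1 - e t x)
      ((integrable_const 1).sub (hint t))
    simp only [RCLike.re_eq_complex_re] at h2
    rw [h2, integral_sub (integrable_const 1) (hint t)]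
    simp
  -- Since `e (s + t) = e s * e t`, the second difference is a single integral, and Cauchy–Schwarz
  -- applies with the norms from `hsq`.
  have hprod : (1 - f (s + t)) - (1 - f s) - (1 - f t)
      = - ∫ x, (1 - e s x) * (1 - e t x) ∂P := by
    have : ∀ x, (1 - e s x) * (1 - e t x) = (1 - e s x - e t x) + e (s + t) x := fun x => by
      rw [hadd]; ring
    simp_rw [this]
    have i1 : Integrable (fun x => 1 - e s x) P := (integrable_const 1).sub (hint s)
    have i2 : Integrable (fun x => 1 - e s x - e t x) P := i1.sub (hint t)
    rw [integral_add i2 (hint _), integral_sub i1 (hint t),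
      integral_sub (integrable_const 1) (hint s), ← hfe, ← hfe, ← hfe]
    simp
    ring
  have hmem : ∀ t, MemLp (fun x => ‖1 - e t x‖) (ENNReal.ofReal 2) P := fun t =>
    MemLp.of_bound (by fun_prop) 2 (ae_of_all _ fun x => by simpa using hbd t x)
  have hH := integral_mul_le_Lp_mul_Lq_of_nonneg (μ := P) (p := 2) (q := 2)
    (Real.holderConjugate_iff.2 ⟨by norm_num, by norm_num⟩)
    (ae_of_all _ fun x => norm_nonneg (1 - e s x)) (ae_of_all _ fun x => norm_nonneg (1 - e t x))
    (hmem s) (hmem t)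
  have hle : ‖(1 - f (s + t)) - (1 - f s) - (1 - f t)‖
      ≤ ∫ x, ‖1 - e s x‖ * ‖1 - e t x‖ ∂P := by
    rw [hprod, norm_neg]
    refine (norm_integral_le_integral_norm _).trans (le_of_eq ?_)
    simp_rw [norm_mul]
  simp_rw [Real.rpow_two] at hH
  rw [hsq, hsq, ← Real.sqrt_eq_rpow, ← Real.sqrt_eq_rpow] at hH
  have hnn : ∀ t, 0 ≤ 2 * (1 - f t).re := fun t => by
    rw [← hsq]
    positivity
  calc _ ≤ (√(2 * (1 - f s).re) * √(2 * (1 - f t).re)) ^ 2 := by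
        gcongr
        exact hle.trans hH
    _ = _ := by
        rw [mul_pow, Real.sq_sqrt (hnn s), Real.sq_sqrt (hnn t)]
        ring

end IsCharFun

/-! ### Continuous logarithms and compound Poisson laws. -/

/-- Two continuous logarithms along the line which agree at `0` are equal. -/
lemma eq_of_exp_eq {u v : ℝ → ℂ} (hu : Continuous u) (hv : Continuous v) (h0 : u 0 = v 0)
    (h : ∀ t, Complex.exp (u t) = Complex.exp (v t)) (t : ℝ) : u t = v t := by
  choose n hn using fun t => Complex.exp_eq_exp_iff_exists_int.1 (h t)
  have h2pi : (2 * Real.pi * Complex.I : ℂ) ≠ 0 := Complex.two_pi_I_ne_zero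
  have hc : Continuous fun t => (n t : ℝ) := by
    have : (fun t => (n t : ℝ)) = fun t => ((u t - v t) / (2 * Real.pi * Complex.I)).re := by
      ext t
      rw [hn t, add_sub_cancel_left, mul_div_cancel_right₀ _ h2pi]
      simp
    rw [this]
    fun_prop
  have hcn : Continuous n := Int.isClosedEmbedding_coe_real.isEmbedding.continuous_iff.2 hc
  have hconst : n t = n 0 := PreconnectedSpace.constant inferInstance hcn
  have hn0 : n 0 = 0 := by
    have := hn 0
    rw [h0, left_eq_add, mul_eq_zero] at this
    exact_mod_cast this.resolve_right h2pi
  rw [hn t, hconst, hn0]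
  simp

/-- A continuous path starting at `0` whose exponential stays near `1` stays near `0`. -/
lemma norm_le_of_norm_one_sub_exp_le {w : ℝ → ℂ} (hw : Continuous w) (h0 : w 0 = 0) {ε δ : ℝ}
    (hε : 0 < ε) (hε' : ε < 1 / 4) (h : ∀ t, |t| ≤ δ → ‖1 - Complex.exp (-w t)‖ ≤ ε) (t : ℝ)
    (ht : |t| ≤ δ) : ‖w t‖ ≤ 2 * ε := by
  by_contra! hlt
  -- If the path exceeded `2ε` it would meet that level, where `‖exp(-w) - 1‖ ≥ 2ε - 4ε²`, which is
  -- more than `ε` because `ε < 1/4`.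
  have hmem : 2 * ε ∈ Set.uIcc ‖w 0‖ ‖w t‖ := by
    rw [h0, norm_zero, Set.uIcc_of_le (norm_nonneg _)]
    exact ⟨by linarith, hlt.le⟩
  obtain ⟨s, hs, hws⟩ := intermediate_value_uIcc (a := 0) (b := t)
    (f := fun t => ‖w t‖) (by fun_prop) hmem
  have hsδ : |s| ≤ δ := by
    have := Set.abs_sub_left_of_mem_uIcc hs
    simp only [sub_zero] at this
    exact this.trans ht
  have h1 := h s hsδ
  have hws' : ‖-w s‖ = 2 * ε := by rw [norm_neg]; exact hws
  have h2 := Complex.norm_exp_sub_one_sub_id_le (x := -w s) (by rw [hws']; linarith)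
  have h3 : ‖-w s‖ ≤ ‖Complex.exp (-w s) - 1 - -w s‖ + ‖1 - Complex.exp (-w s)‖ := by
    rw [← norm_neg (-w s)]
    refine le_trans (le_of_eq ?_) (norm_add_le _ _)
    congr 1
    ring
  rw [hws'] at h2 h3
  nlinarith

lemma norm_one_sub_pow_le {z : ℂ} (hz : ‖z‖ ≤ 1) (m : ℕ) : ‖1 - z ^ m‖ ≤ m * ‖1 - z‖ := by
  induction m with
  | zero => simp
  | succ m ih =>
    have : 1 - z ^ (m + 1) = (1 - z ^ m) + z ^ m * (1 - z) := by ring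
    rw [this]
    refine (norm_add_le _ _).trans ?_
    have h1 : ‖z ^ m * (1 - z)‖ ≤ ‖1 - z‖ := by
      rw [norm_mul, norm_pow]
      exact mul_le_of_le_one_left (norm_nonneg _) (pow_le_one₀ (norm_nonneg _) hz)
    push_cast
    linarith

/-- The characteristic function of a compound Poisson law. -/
lemma IsCharFun.compoundPoisson {h : ℝ → ℂ} (hh : IsCharFun h) {r : ℝ} (hr : 0 ≤ r) :
    IsCharFun fun t => Complex.exp (-(r * (1 - h t))) := by
  -- The cap at `1` makes `p m` a probability for every `m`; eventually it is `r / m`, and the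
  -- `m`-th powers are binomial approximations.
  let p : ℕ → ℝ := fun m => min 1 (r / m)
  have hp0 : ∀ m, 0 ≤ p m := fun m => le_min zero_le_one (by positivity)
  have hp1 : ∀ m, p m ≤ 1 := fun m => min_le_left _ _
  have hb : ∀ m, IsCharFun fun t => 1 + (p m : ℂ) * (h t - 1) := fun m =>
    hh.convex_one (hp0 m) (hp1 m)
  refine IsCharFun.of_tendsto_ultrafilter (U := Ultrafilter.of (atTop : Filter ℕ))
    (χ := fun m t => (1 + (p m : ℂ) * (h t - 1)) ^ m) (fun m => (hb m).pow m) ?_ ?_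
  · intro ε hε
    have hc : Tendsto (fun t => r * ‖1 - h t‖) (𝓝 0) (𝓝 0) := by
      have : Continuous fun t => r * ‖1 - h t‖ := by
        have := hh.continuous
        fun_prop
      simpa [hh.map_zero] using this.tendsto 0
    obtain ⟨δ, hδ, hd⟩ := Metric.eventually_nhds_iff.1 (hc.eventually (gt_mem_nhds hε))
    refine ⟨δ / 2, by positivity, fun m t ht => ?_⟩
    have ht' : dist t 0 < δ := by
      rw [Real.dist_0_eq_abs]
      linarith
    refine (norm_one_sub_pow_le ((hb m).norm_le_one t) m).trans (le_trans ?_ (hd ht').le)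
    have : 1 - (1 + (p m : ℂ) * (h t - 1)) = p m * (1 - h t) := by ring
    rw [this, norm_mul, ← mul_assoc, Complex.norm_real, Real.norm_of_nonneg (hp0 m)]
    gcongr
    rcases Nat.eq_zero_or_pos m with rfl | hm
    · simpa using hr
    · have hm' : (0 : ℝ) < m := by exact_mod_cast hm
      calc (m : ℝ) * p m ≤ m * (r / m) := by gcongr; exact min_le_right _ _
        _ = r := by field_simp
  · intro t
    refine Tendsto.mono_left ?_ (Ultrafilter.of_le _)
    refine Complex.tendsto_one_add_pow_exp_of_tendsto (tendsto_const_nhds.congr' ?_)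
    filter_upwards [eventually_ge_atTop (max 1 ⌈r⌉₊)] with m hm
    have hm1 : (1 : ℝ) ≤ m := by exact_mod_cast (le_max_left _ _).trans hm
    have hmr : r ≤ m := (Nat.le_ceil r).trans (by exact_mod_cast (le_max_right _ _).trans hm)
    have hpm : p m = r / m := min_eq_right ((div_le_one (by linarith)).2 hmr)
    have hm0 : (m : ℂ) ≠ 0 := by
      have : (m : ℝ) ≠ 0 := by linarith
      exact_mod_cast this
    rw [hpm]
    push_cast
    field_simp
    ring

/-! ### Lévy exponents. -/

/-- The exponent `ψ` of a weakly continuous convolution semigroup of probability laws, with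
characteristic functions `exp (-u ψ)`, `0 ≤ u`. -/
structure IsLevyExponent (ψ : ℝ → ℂ) : Prop where
  continuous : Continuous ψ
  map_zero : ψ 0 = 0
  isCharFun : ∀ u : ℝ, 0 ≤ u → IsCharFun fun t => Complex.exp (-(u * ψ t))

namespace IsLevyExponent

variable {ψ : ℝ → ℂ}

lemma isCharFun_one (hψ : IsLevyExponent ψ) : IsCharFun fun t => Complex.exp (-ψ t) := by
  simpa using hψ.isCharFun 1 zero_le_one

lemma re_nonneg (hψ : IsLevyExponent ψ) (t : ℝ) : 0 ≤ (ψ t).re := by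
  have := hψ.isCharFun_one.norm_le_one t
  rw [Complex.norm_exp, Real.exp_le_one_iff] at this
  simpa using this

lemma comp_neg (hψ : IsLevyExponent ψ) : IsLevyExponent fun t => ψ (-t) where
  continuous := hψ.continuous.comp continuous_neg
  map_zero := by simpa using hψ.map_zero
  isCharFun u hu := by simpa using (hψ.isCharFun u hu).comp_mul (-1)

lemma isNegLog (hψ : IsLevyExponent ψ) : IsNegLog ψ fun t => Complex.exp (-ψ t) :=
  ⟨hψ.continuous, hψ.map_zero, fun _ => rfl⟩

lemma I_mul (b : ℝ) : IsLevyExponent fun t => Complex.I * b * t where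
  continuous := by fun_prop
  map_zero := by simp
  isCharFun u hu := by
    convert! IsCharFun.exp_I_mul (-(u * b)) using 3 with t
    push_cast
    ring

/-- The compound Poisson exponent with drift. -/
lemma compoundPoisson {h : ℝ → ℂ} (hh : IsCharFun h) {r : ℝ} (hr : 0 ≤ r) (a m : ℝ) :
    IsLevyExponent fun t => (r : ℂ) * (1 - h (t / a)) + Complex.I * t * m where
  continuous := by
    have := hh.continuous
    fun_prop
  map_zero := by simp [hh.map_zero]
  isCharFun u hu := by
    have h1 := ((hh.comp_mul a⁻¹).compoundPoisson (mul_nonneg hu hr)).mul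
      (IsCharFun.exp_I_mul (-(u * m)))
    convert! h1 using 2 with t
    rw [← Complex.exp_add, div_eq_inv_mul]
    congr 1
    push_cast
    ring

end IsLevyExponent

/-! ### The Laplace transform on the half-plane. -/

section Laplace

variable {ν : Measure ℝ}

lemma ae_nonneg_of_measure_Iio (hν : ν (Set.Iio 0) = 0) : ∀ᵐ u ∂ν, 0 ≤ u := by
  rw [ae_iff]
  simpa [Set.Iio] using hν

lemma norm_exp_neg_mul_le_one {z : ℂ} (hz : 0 ≤ z.re) {u : ℝ} (hu : 0 ≤ u) :
    ‖Complex.exp (-(z * u))‖ ≤ 1 := by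
  rw [Complex.norm_exp, Real.exp_le_one_iff]
  simpa using mul_nonneg hz hu

lemma laplaceTransform_ofReal (s : ℝ) :
    laplaceTransform ν s = ((∫ u, Real.exp (-(s * u)) ∂ν : ℝ) : ℂ) := by
  rw [laplaceTransform, ← integral_complex_ofReal]
  congr 1 with u
  push_cast
  rfl

variable [IsProbabilityMeasure ν]

lemma integrable_exp_neg_mul (hν : ν (Set.Iio 0) = 0) {z : ℂ} (hz : 0 ≤ z.re) :
    Integrable (fun u : ℝ => Complex.exp (-(z * u))) ν :=
  Integrable.of_bound (by fun_prop) 1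
    ((ae_nonneg_of_measure_Iio hν).mono fun _ hu => norm_exp_neg_mul_le_one hz hu)

lemma norm_laplaceTransform_le_one (hν : ν (Set.Iio 0) = 0) {z : ℂ} (hz : 0 ≤ z.re) :
    ‖laplaceTransform ν z‖ ≤ 1 := by
  refine (norm_integral_le_of_norm_le_const (C := 1)
    ((ae_nonneg_of_measure_Iio hν).mono fun _ hu => norm_exp_neg_mul_le_one hz hu)).trans ?_
  simp

lemma continuousOn_laplaceTransform (hν : ν (Set.Iio 0) = 0) :
    ContinuousOn (laplaceTransform ν) {z | 0 ≤ z.re} := by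
  refine continuousOn_of_dominated (bound := fun _ => 1) (fun z _ => by fun_prop) (fun z hz => ?_)
    (integrable_const 1) (ae_of_all _ fun u => by fun_prop)
  exact (ae_nonneg_of_measure_Iio hν).mono fun _ hu => norm_exp_neg_mul_le_one hz hu

lemma differentiableOn_laplaceTransform (hν : ν (Set.Iio 0) = 0) :
    DifferentiableOn ℂ (laplaceTransform ν) {z | 0 < z.re} := by
  have heq : laplaceTransform ν = fun z => ProbabilityTheory.complexMGF id ν (-z) := by
    ext z
    simp [laplaceTransform, ProbabilityTheory.complexMGF]
  have hsub : Set.Iio 0 ⊆ interior (ProbabilityTheory.integrableExpSet id ν) := by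
    refine interior_maximal (fun x hx => ?_) isOpen_Iio
    refine Integrable.of_bound (by fun_prop) 1
      ((ae_nonneg_of_measure_Iio hν).mono fun u hu => ?_)
    rw [Real.norm_of_nonneg (Real.exp_pos _).le, Real.exp_le_one_iff]
    exact mul_nonpos_of_nonpos_of_nonneg (le_of_lt hx) hu
  rw [heq]
  refine ProbabilityTheory.differentiableOn_complexMGF.comp (by fun_prop) fun z hz => ?_
  exact hsub (by simpa using hz)

/-- For `a < b` the two integrands are ordered on `[0, ∞)` and agree only at `u = 0`, whereas `ν`
charges `(0, ∞)`. -/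
lemma integral_exp_neg_mul_inj (hν : ν (Set.Iio 0) = 0) (hpos : ν (Set.Ioi 0) ≠ 0) {a b : ℝ}
    (ha : 0 ≤ a) (hb : 0 ≤ b)
    (h : ∫ u, Real.exp (-(a * u)) ∂ν = ∫ u, Real.exp (-(b * u)) ∂ν) : a = b := by
  wlog hab : a < b generalizing a b
  · rcases lt_trichotomy a b with h1 | h1 | h1
    · exact this ha hb h h1
    · exact h1
    · exact (this hb ha h.symm h1).symm
  exfalso
  have hi : ∀ {s : ℝ}, 0 ≤ s → Integrable (fun u => Real.exp (-(s * u))) ν := fun {s} hs => by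
    refine Integrable.of_bound (by fun_prop) 1
      ((ae_nonneg_of_measure_Iio hν).mono fun u hu => ?_)
    rw [Real.norm_of_nonneg (Real.exp_pos _).le, Real.exp_le_one_iff]
    simpa using mul_nonneg hs hu
  have h0 : ∫ u, (Real.exp (-(a * u)) - Real.exp (-(b * u))) ∂ν = 0 := by
    rw [integral_sub (hi ha) (hi hb), h, sub_self]
  rw [integral_eq_zero_iff_of_nonneg_ae] at h0
  · refine hpos (measure_mono_null (t := {u : ℝ | ¬ (u ≤ 0)}) (fun u hu => not_le.2 hu) ?_)
    rw [← ae_iff]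
    filter_upwards [h0] with u hu
    by_contra! hu0
    have : Real.exp (-(b * u)) < Real.exp (-(a * u)) := by
      rw [Real.exp_lt_exp]
      nlinarith
    simp only [Pi.zero_apply] at hu
    linarith
  · filter_upwards [ae_nonneg_of_measure_Iio hν] with u hu
    simp only [Pi.zero_apply, sub_nonneg, Real.exp_le_exp]
    nlinarith
  · exact (hi ha).sub (hi hb)

lemma laplaceTransform_eq_one_of_measure_Ioi (hν : ν (Set.Iio 0) = 0) (h0 : ν (Set.Ioi 0) = 0)
    (z : ℂ) : laplaceTransform ν z = 1 := by
  have : ∀ᵐ u ∂ν, u ≤ 0 := by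
    rw [ae_iff]
    simpa [Set.Ioi] using h0
  rw [laplaceTransform, integral_congr_ae (g := fun _ => 1)]
  · simp
  · filter_upwards [ae_nonneg_of_measure_Iio hν, this] with u h1 h2
    simp [le_antisymm h2 h1]

end Laplace

/-! ### Boundary uniqueness and convergence from level sets. -/

/-- A function holomorphic in the right half-plane and continuous up to the boundary which vanishes
on a segment of the imaginary axis vanishes identically. -/
lemma eqOn_zero_of_eq_zero_on_segment {F : ℂ → ℂ} (hc : ContinuousOn F {z | 0 ≤ z.re})
    (hd : DifferentiableOn ℂ F {z | 0 < z.re}) {y₁ y₂ : ℝ} (hy : y₁ < y₂)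
    (h0 : ∀ y ∈ Set.Ioo y₁ y₂, F (y * Complex.I) = 0) :
    ∀ z : ℂ, 0 < z.re → F z = 0 := by
  have hopen : IsOpen {z : ℂ | 0 < z.re} := isOpen_lt continuous_const Complex.continuous_re
  have key : ∀ p : ℂ, 0 < p.re → y₁ < p.im - p.re → p.im + p.re < y₂ → F p = 0 := by
    intro p hp h1 h2
    set x := p.re with hx
    let R : ℂ → ℂ → ℂ := fun c z => p + c * (z - p)
    -- Product over the quarter-turns about `p`. On each side of the square centred at `p` with
    -- half-side `Re p`, one factor is evaluated on the segment where `F` vanishes. The maximum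
    -- principle gives `G p = F p ^ 4 = 0`.
    let G : ℂ → ℂ := fun z => F (R 1 z) * F (R Complex.I z) * F (R (-1) z) * F (R (-Complex.I) z)
    let S : Set ℂ := Set.Ioo 0 (2 * x) ×ℂ Set.Ioo (p.im - x) (p.im + x)
    let K : Set ℂ := Set.Icc 0 (2 * x) ×ℂ Set.Icc (p.im - x) (p.im + x)
    have hK : closure S = K := by
      rw [Complex.closure_reProdIm, closure_Ioo (by linarith), closure_Ioo (by linarith)]
    have hmapK : ∀ c, c = 1 ∨ c = Complex.I ∨ c = -1 ∨ c = -Complex.I → Set.MapsTo (R c) K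
        {z | 0 ≤ z.re} := by
      rintro c hcc z ⟨hz1, hz2⟩
      simp only [Set.mem_preimage, Set.mem_Icc] at hz1 hz2
      rcases hcc with rfl | rfl | rfl | rfl <;> simp [R, ← hx] <;> linarith
    have hmapS : ∀ c, c = 1 ∨ c = Complex.I ∨ c = -1 ∨ c = -Complex.I → Set.MapsTo (R c) S
        {z | 0 < z.re} := by
      rintro c hcc z ⟨hz1, hz2⟩
      simp only [Set.mem_preimage, Set.mem_Ioo] at hz1 hz2
      rcases hcc with rfl | rfl | rfl | rfl <;> simp [R, ← hx] <;> linarith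
    have hGd : DiffContOnCl ℂ G S := by
      have hdiff : ∀ c, c = 1 ∨ c = Complex.I ∨ c = -1 ∨ c = -Complex.I →
          DiffContOnCl ℂ (fun z => F (R c z)) S := fun c hcc =>
        ⟨hd.comp (by fun_prop) (hmapS c hcc), by
          rw [hK]; exact hc.comp (by fun_prop) (hmapK c hcc)⟩
      have hmul : ∀ {u v : ℂ → ℂ}, DiffContOnCl ℂ u S → DiffContOnCl ℂ v S →
          DiffContOnCl ℂ (fun z => u z * v z) S := fun hu hv =>
        ⟨hu.1.mul hv.1, hu.2.mul hv.2⟩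
      exact hmul (hmul (hmul (hdiff _ (by simp)) (hdiff _ (by simp))) (hdiff _ (by simp)))
        (hdiff _ (by simp))
    have hedge : ∀ z : ℂ, z.re = 0 → p.im - x ≤ z.im → z.im ≤ p.im + x → F z = 0 := by
      intro z hz h3 h4
      have := h0 z.im ⟨by linarith, by linarith⟩
      rwa [show (z.im : ℂ) * Complex.I = z from by
        apply Complex.ext <;> simp [hz]] at this
    have hfr : ∀ z ∈ frontier S, ‖G z‖ ≤ 0 := by
      intro z hz
      rw [Complex.frontier_reProdIm, frontier_Ioo (by linarith), frontier_Ioo (by linarith),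
        closure_Ioo (by linarith), closure_Ioo (by linarith)] at hz
      rw [norm_le_zero_iff]
      rcases hz with ⟨hz1, hz2⟩ | ⟨hz1, hz2⟩ <;>
      simp only [Set.mem_preimage, Set.mem_Icc, Set.mem_insert_iff, Set.mem_singleton_iff]
        at hz1 hz2
      · rcases hz2 with hz2 | hz2
        · have : F (R (-Complex.I) z) = 0 := by
            apply hedge <;> simp [R, ← hx, hz2] <;> linarith
          simp only [G, this, mul_zero]
        · have : F (R Complex.I z) = 0 := by
            apply hedge <;> simp [R, ← hx, hz2] <;> linarith
          simp only [G, this, mul_zero, zero_mul]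
      · rcases hz1 with hz1 | hz1
        · have : F (R 1 z) = 0 := by
            apply hedge <;> simp [R, hz1] <;> linarith
          simp only [G, this, zero_mul]
        · have : F (R (-1) z) = 0 := by
            apply hedge <;> simp [R, ← hx, hz1] <;> linarith
          simp only [G, this, mul_zero, zero_mul]
    have hbd : Bornology.IsBounded S :=
      (Metric.isBounded_Ioo _ _).reProdIm (Metric.isBounded_Ioo _ _)
    have hpS : p ∈ closure S := subset_closure
      ⟨⟨hp, by simp [← hx]; linarith⟩, ⟨by simp; linarith, by simp; linarith⟩⟩
    have := Complex.norm_le_of_forall_mem_frontier_norm_le hbd hGd hfr hpS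
    rw [norm_le_zero_iff] at this
    simpa [G, R] using this
  have han : AnalyticOnNhd ℂ F {z | 0 < z.re} := hd.analyticOnNhd hopen
  -- An interior point of the triangle over the segment on which `key` applies.
  let p₀ : ℂ := ⟨(y₂ - y₁) / 4, (y₁ + y₂) / 2⟩
  have hp₀ : 0 < p₀.re := by simp only [p₀]; linarith
  have hev : ∀ᶠ z in 𝓝 p₀, F z = 0 := by
    have o1 : ∀ᶠ z : ℂ in 𝓝 p₀, 0 < z.re := hopen.mem_nhds hp₀
    have o2 : ∀ᶠ z : ℂ in 𝓝 p₀, y₁ < z.im - z.re :=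
      (isOpen_lt continuous_const (Complex.continuous_im.sub Complex.continuous_re)).mem_nhds
        (by simp only [Set.mem_ofPred_eq, p₀, Pi.sub_apply]; linarith)
    have o3 : ∀ᶠ z : ℂ in 𝓝 p₀, z.im + z.re < y₂ :=
      (isOpen_lt (Complex.continuous_im.add Complex.continuous_re) continuous_const).mem_nhds
        (by simp only [Set.mem_ofPred_eq, p₀, Pi.add_apply]; linarith)
    filter_upwards [o1, o2, o3] with z h1 h2 h3 using key z h1 h2 h3
  intro z hz
  exact han.eqOn_zero_of_preconnected_of_eventuallyEq_zero
    (convex_halfSpace_re_gt 0).isPreconnected hp₀ hev hz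

/-- A bounded sequence with vanishing increments in the closed right half-plane, along which a
nonconstant holomorphic function converges, is itself convergent. -/
lemma exists_tendsto_of_tendsto_comp {F : ℂ → ℂ} (hc : ContinuousOn F {z | 0 ≤ z.re})
    (hd : DifferentiableOn ℂ F {z | 0 < z.re}) {z : ℕ → ℂ} {w : ℂ}
    (hne : ∃ p : ℂ, 0 < p.re ∧ F p ≠ w) (hre : ∀ n, 0 ≤ (z n).re)
    {B : ℝ} (hB : ∀ n, ‖z n‖ ≤ B) (hstep : Tendsto (fun n => z (n + 1) - z n) atTop (𝓝 0))
    (hF : Tendsto (fun n => F (z n)) atTop (𝓝 w)) : ∃ l, Tendsto z atTop (𝓝 l) := by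
  have hopen : IsOpen {z : ℂ | 0 < z.re} := isOpen_lt continuous_const Complex.continuous_re
  have hclosed : IsClosed {z : ℂ | 0 ≤ z.re} := isClosed_le continuous_const Complex.continuous_re
  have hclus : ∀ l, MapClusterPt l atTop z → 0 ≤ l.re ∧ F l = w := by
    intro l hl
    have hl0 : 0 ≤ l.re := hclosed.mem_of_mapClusterPt hl (.of_forall hre)
    refine ⟨hl0, ?_⟩
    obtain ⟨φ, hφ, hlim⟩ := hl.tendsto_subseq
    have h1 : Tendsto (fun n => F (z (φ n))) atTop (𝓝 (F l)) :=
      (hc l hl0).tendsto.comp (tendsto_nhdsWithin_iff.2 ⟨hlim, .of_forall fun n => hre _⟩)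
    exact tendsto_nhds_unique h1 (hF.comp hφ.tendsto_atTop)
  have hcpt : IsCompact (Metric.closedBall (0 : ℂ) B) := isCompact_closedBall _ _
  have hmem : ∀ n, z n ∈ Metric.closedBall (0 : ℂ) B := fun n => by simpa using hB n
  have hfreq : ∀ S : Set ℂ, IsClosed S → (∃ᶠ n in atTop, z n ∈ S) →
      ∃ l ∈ S, MapClusterPt l atTop z := by
    intro S hS hfr
    obtain ⟨l, hl, hl'⟩ := (hcpt.inter_right hS).exists_mapClusterPt_of_frequently
      (l := atTop) (f := z) (hfr.mono fun n hn => ⟨hmem n, hn⟩)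
    exact ⟨l, hl.2, hl'⟩
  obtain ⟨l₀, -, hl₀⟩ := hfreq Set.univ isClosed_univ (Frequently.of_forall fun _ => trivial)
  have hstep' : ∀ ε > 0, ∀ᶠ n in atTop, ‖z (n + 1) - z n‖ < ε := fun ε hε => by
    simpa using hstep.eventually (Metric.ball_mem_nhds 0 hε)
  by_cases hin : ∃ l, MapClusterPt l atTop z ∧ 0 < l.re
  · obtain ⟨l, hl, hlre⟩ := hin
    refine ⟨l, ?_⟩
    have han : AnalyticOnNhd ℂ (fun z => F z - w) {z | 0 < z.re} :=
      (hd.sub_const w).analyticOnNhd hopen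
    have hiso : ∀ᶠ y in 𝓝[≠] l, F y - w ≠ 0 := by
      refine (han l hlre).eventually_eq_zero_or_eventually_ne_zero.resolve_left fun h => ?_
      obtain ⟨p, hp, hpw⟩ := hne
      exact hpw (sub_eq_zero.1 (han.eqOn_zero_of_preconnected_of_eventuallyEq_zero
        (convex_halfSpace_re_gt 0).isPreconnected hlre h hp))
    rw [eventually_nhdsWithin_iff, Metric.eventually_nhds_iff] at hiso
    obtain ⟨r, hr, hiso⟩ := hiso
    rw [Metric.tendsto_atTop']
    intro ε hε
    set ρ := min (r / 2) ε with hρdef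
    have hρ : 0 < ρ := lt_min (by positivity) hε
    -- An interior cluster point is isolated in the level set, so the sequence eventually avoids an
    -- annulus around it. Steps shorter than the annulus's width cannot cross it.
    have hann : ∀ᶠ n in atTop, ¬ (ρ / 2 ≤ dist (z n) l ∧ dist (z n) l ≤ ρ) := by
      by_contra hcon
      rw [not_eventually] at hcon
      simp only [not_not] at hcon
      have hcl : IsClosed {y : ℂ | ρ / 2 ≤ dist y l ∧ dist y l ≤ ρ} :=
        (isClosed_le continuous_const (continuous_id.dist continuous_const)).inter
          (isClosed_le (continuous_id.dist continuous_const) continuous_const)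
      obtain ⟨y, hy, hyc⟩ := hfreq _ hcl hcon
      have hy1 : ρ / 2 ≤ dist y l := hy.1
      have hy2 : dist y l ≤ ρ := hy.2
      have hylt : dist y l < r := by
        have : ρ ≤ r / 2 := min_le_left _ _
        linarith
      have hyne : y ≠ l := by
        rintro rfl
        rw [dist_self] at hy1
        linarith
      exact hiso hylt hyne (sub_eq_zero.2 (hclus y hyc).2)
    obtain ⟨N, hN⟩ := eventually_atTop.1 (hann.and (hstep' (ρ / 2) (by positivity)))
    obtain ⟨M, hMN, hM⟩ := (frequently_atTop.1
      (hl.frequently (Metric.ball_mem_nhds l (half_pos hρ)))) N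
    refine ⟨M, fun n hn => ?_⟩
    suffices dist (z n) l < ρ / 2 by
      have : ρ ≤ ε := min_le_right _ _
      linarith
    induction n, hn.le using Nat.le_induction with
    | base => exact hM
    | succ n hmn ih =>
      have ih' : dist (z n) l < ρ / 2 := by
        rcases hmn.eq_or_lt with rfl | hlt
        · exact hM
        · exact ih hlt
      obtain ⟨-, h2⟩ := hN n (hMN.trans hmn)
      obtain ⟨h1, -⟩ := hN (n + 1) (hMN.trans (hmn.trans n.le_succ))
      by_contra! hge
      refine h1 ⟨hge, ?_⟩
      have := dist_triangle (z (n + 1)) (z n) l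
      rw [dist_eq_norm (z (n + 1)) (z n)] at this
      linarith
  · push Not at hin
    have hre0 : ∀ l, MapClusterPt l atTop z → l.re = 0 := fun l hl =>
      le_antisymm (hin l hl) (hclus l hl).1
    refine ⟨l₀, ?_⟩
    refine hcpt.tendsto_nhds_of_unique_mapClusterPt (.of_forall hmem) fun l _ hl => ?_
    -- All cluster points are now on the imaginary axis. Between two different ones, small steps
    -- force every intermediate height to be approached infinitely often, so `F = w` on a whole
    -- segment and hence throughout the half-plane.
    have hmain : ∀ l l', MapClusterPt l atTop z → MapClusterPt l' atTop z → ¬ l.im < l'.im := by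
      intro l l' hl hl' hlt
      obtain ⟨p, hp, hpw⟩ := hne
      refine hpw (sub_eq_zero.1 (eqOn_zero_of_eq_zero_on_segment (F := fun z => F z - w)
        (hc.sub continuousOn_const) (hd.sub_const w) hlt (fun y hy => ?_) p hp))
      have hcy : MapClusterPt (y * Complex.I) atTop z := by
        have him : ∀ ε > 0, ∃ᶠ n in atTop, |(z n).im - y| ≤ ε := by
          intro ε hε
          rw [frequently_atTop]
          intro N
          obtain ⟨N', hN'⟩ := eventually_atTop.1 (hstep' ε hε)
          have f1 : ∃ᶠ n in atTop, (z n).im < y :=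
            hl.frequently ((isOpen_lt Complex.continuous_im continuous_const).mem_nhds hy.1)
          have f2 : ∃ᶠ n in atTop, y < (z n).im :=
            hl'.frequently ((isOpen_lt continuous_const Complex.continuous_im).mem_nhds hy.2)
          obtain ⟨m, hm, hmy⟩ := frequently_atTop.1 f1 (max N N')
          obtain ⟨k, hk, hky⟩ := frequently_atTop.1 f2 m
          by_contra! hno
          have : ∀ n, m ≤ n → (z n).im < y := by
            intro n hn
            induction n, hn using Nat.le_induction with
            | base => exact hmy
            | succ n hmn ih =>
              by_contra! hge
              have hs := hN' n ((le_max_right _ _).trans (hm.trans hmn))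
              have him' := (Complex.abs_im_le_norm _).trans hs.le
              rw [Complex.sub_im, abs_le] at him'
              have h3 := hno n ((le_max_left _ _).trans (hm.trans hmn))
              rw [abs_of_neg (by linarith)] at h3
              linarith
          exact absurd (this k hk) (not_lt.2 hky.le)
        rw [mapClusterPt_iff_frequently]
        intro s hs
        obtain ⟨ε, hε, hεs⟩ := Metric.mem_nhds_iff.1 hs
        have hre : ∀ᶠ n in atTop, |(z n).re| < ε / 2 := by
          by_contra hcon
          rw [not_eventually] at hcon
          simp only [not_lt] at hcon
          obtain ⟨v, hv, hvc⟩ := hfreq {v | ε / 2 ≤ |v.re|}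
            (isClosed_le continuous_const (by fun_prop)) hcon
          have hv' : ε / 2 ≤ |v.re| := hv
          rw [hre0 v hvc, abs_zero] at hv'
          linarith
        refine ((him (ε / 3) (by positivity)).and_eventually hre).mono fun n hn => hεs ?_
        rw [Metric.mem_ball, dist_eq_norm]
        refine (Complex.norm_le_abs_re_add_abs_im _).trans_lt ?_
        simp only [Complex.sub_re, Complex.sub_im, Complex.mul_re, Complex.mul_im,
          Complex.ofReal_re, Complex.ofReal_im, Complex.I_re, Complex.I_im, mul_zero, mul_one,
          sub_zero, add_zero]
        linarith [hn.1, hn.2]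
      exact sub_eq_zero.2 (hclus _ hcy).2
    apply Complex.ext
    · rw [hre0 l hl, hre0 l₀ hl₀]
    · exact le_antisymm (not_lt.1 (hmain _ _ hl₀ hl)) (not_lt.1 (hmain _ _ hl hl₀))

/-! ### Equicontinuity at `0` from convergence of the sampled laws. -/

/-- The integrand is at most `|t| r` on `|x| ≤ r` and at most `2` elsewhere. This turns a tail bound
back into closeness to `1` near `0`. -/
lemma norm_one_sub_charFun_le (P : Measure ℝ) [IsProbabilityMeasure P] {r : ℝ} (hr : 0 ≤ r)
    (t : ℝ) :
    ‖1 - charFun P t‖ ≤ |t| * r + 2 * P.real {x | r < |x|} := by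
  have hm : MeasurableSet {x : ℝ | r < |x|} :=
    (isOpen_lt continuous_const continuous_abs).measurableSet
  have hne : ∀ x : ℝ, ‖Complex.exp (t * x * Complex.I)‖ = 1 := fun x => by
    rw [← Complex.ofReal_mul, Complex.norm_exp_ofReal_mul_I]
  have hint : Integrable (fun x : ℝ => Complex.exp (t * x * Complex.I)) P :=
    Integrable.of_bound (by fun_prop) 1 (ae_of_all _ fun x => (hne x).le)
  have h1 : 1 - charFun P t = ∫ x : ℝ, (1 - Complex.exp (t * x * Complex.I)) ∂P := by
    rw [integral_sub (integrable_const 1) hint, charFun_apply_real]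
    simp
  have hind : Integrable ({x : ℝ | r < |x|}.indicator fun _ => (2 : ℝ)) P :=
    (integrable_const 2).indicator hm
  rw [h1]
  refine (norm_integral_le_of_norm_le (g := fun x => |t| * r + {x : ℝ | r < |x|}.indicator
    (fun _ => (2 : ℝ)) x) ((integrable_const _).add hind) (ae_of_all _ fun x => ?_)).trans ?_
  · by_cases hx : r < |x|
    · rw [Set.indicator_of_mem (by exact hx)]
      have : ‖1 - Complex.exp (t * x * Complex.I)‖ ≤ 2 :=
        (norm_sub_le _ _).trans (by rw [hne, norm_one]; norm_num)
      have := mul_nonneg (abs_nonneg t) hr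
      linarith
    · rw [Set.indicator_of_notMem (by exact hx), add_zero, norm_sub_rev,
        show (t * x * Complex.I : ℂ) = Complex.I * ((t * x : ℝ) : ℂ) by push_cast; ring]
      refine (Real.norm_exp_I_mul_ofReal_sub_one_le).trans ?_
      rw [Real.norm_eq_abs, abs_mul]
      gcongr
      exact not_lt.1 hx
  · rw [integral_add (integrable_const _) hind, integral_indicator hm]
    simp [mul_comm]

section Tightness

variable {ν : Measure ℝ} [IsProbabilityMeasure ν]

lemma exists_pos_measure_Ici_ne_zero {ν : Measure ℝ} (hpos : ν (Set.Ioi 0) ≠ 0) :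
    ∃ u : ℝ, 0 < u ∧ ν (Set.Ici u) ≠ 0 := by
  by_contra! h
  refine hpos (measure_mono_null (t := ⋃ n : ℕ, Set.Ici (1 / ((n : ℝ) + 1))) (fun x hx => ?_)
    (measure_iUnion_null fun n => h _ (by positivity)))
  obtain ⟨n, hn⟩ := exists_nat_one_div_lt (show (0 : ℝ) < x from hx)
  exact Set.mem_iUnion.2 ⟨n, hn.le⟩

/-- Conjugating a characteristic function reflects `t`, and the interval is symmetric. -/
lemma im_integral_one_sub_eq_zero {χ : ℝ → ℂ} (hχ : IsCharFun χ) (τ : ℝ) :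
    (∫ t in (-τ)..τ, (1 - χ t)).im = 0 := by
  have hii : IntervalIntegrable (fun t => 1 - χ t) volume (-τ) τ :=
    (continuous_const.sub hχ.continuous).intervalIntegrable _ _
  obtain ⟨P, hP, h⟩ := hχ
  have hconj := Complex.conjCLE.toContinuousLinearMap.intervalIntegral_comp_comm hii
  simp only [ContinuousLinearEquiv.coe_coe, Complex.conjCLE_apply] at hconj
  rw [← Complex.conj_eq_iff_im, ← hconj]
  have h1 : ∀ t, (starRingEnd ℂ) (1 - χ t) = 1 - χ (-t) := fun t => by
    rw [h, h, charFun_neg]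
    simp
  simp_rw [h1]
  simpa using intervalIntegral.integral_comp_neg (a := -τ) (b := τ) fun t => 1 - χ t

lemma integral_one_sub_laplaceTransform (hν : ν (Set.Iio 0) = 0) {ψ : ℝ → ℂ}
    (hψ : IsLevyExponent ψ) {τ : ℝ} (hτ : 0 ≤ τ) :
    Integrable (fun u : ℝ => ∫ t in (-τ)..τ, (1 - Complex.exp (-(u * ψ t)))) ν ∧
    ∫ t in (-τ)..τ, (1 - laplaceTransform ν (ψ t)) =
      ∫ u : ℝ, (∫ t in (-τ)..τ, (1 - Complex.exp (-(u * ψ t)))) ∂ν := by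
  have hle : -τ ≤ τ := by linarith
  have hψc := hψ.continuous
  have hint : Integrable (Function.uncurry fun (t u : ℝ) => 1 - Complex.exp (-(u * ψ t)))
      ((volume.restrict (Set.Ioc (-τ) τ)).prod ν) := by
    refine Integrable.of_bound (by fun_prop) 2 ?_
    have := (Measure.quasiMeasurePreserving_snd (μ := volume.restrict (Set.Ioc (-τ) τ))
      (ν := ν)).ae (ae_nonneg_of_measure_Iio hν)
    filter_upwards [this] with x hx
    refine (norm_sub_le _ _).trans ?_
    have := (hψ.isCharFun _ hx).norm_le_one x.1
    rw [norm_one]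
    linarith
  constructor
  · simp_rw [intervalIntegral.integral_of_le hle]
    exact hint.integral_prod_right
  · simp_rw [intervalIntegral.integral_of_le hle]
    rw [← integral_integral_swap hint]
    refine integral_congr_ae (ae_of_all _ fun t => ?_)
    have hi := integrable_exp_neg_mul hν (hψ.re_nonneg t)
    simp only [laplaceTransform]
    simp_rw [mul_comm _ (ψ t)]
    rw [integral_sub (integrable_const 1) hi]
    simp

/-- If the laws with characteristic functions `φ (ψ n)` converge weakly, then the exponents `ψ n`
are equicontinuous at `0`. -/
lemma exists_forall_norm_le_of_tendsto_laplaceTransform (hν : ν (Set.Iio 0) = 0)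
    (hpos : ν (Set.Ioi 0) ≠ 0) {ψ : ℕ → ℝ → ℂ} (hψ : ∀ n, IsLevyExponent (ψ n)) {f : ℝ → ℂ}
    (hf : IsCharFun f)
    (hlim : ∀ t, Tendsto (fun n => laplaceTransform ν (ψ n t)) atTop (𝓝 (f t)))
    {ε : ℝ} (hε : 0 < ε) : ∃ δ > 0, ∀ n t, |t| ≤ δ → ‖ψ n t‖ ≤ ε := by
  obtain ⟨u₀, hu₀, hu₀ν⟩ := exists_pos_measure_Ici_ne_zero hpos
  set p : ℝ := ν.real (Set.Ici u₀) with hp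
  have hp0 : 0 < p := ENNReal.toReal_pos hu₀ν (measure_ne_top _ _)
  set e : ℝ := min (1 / 8) (ε * u₀ / 2) with he
  have he0 : 0 < e := lt_min (by norm_num) (by positivity)
  have he1 : e < 1 / 4 := (min_le_left _ _).trans_lt (by norm_num)
  -- The `12` makes the tail bound below equal `e / 3`; the term `|t| r` and twice the tail then add
  -- up to at most `e`.
  set η : ℝ := p * e / 12 with hη
  have hη0 : 0 < η := by positivity
  obtain ⟨τ, hτ, hτf⟩ : ∃ τ > 0, ∀ t, |t| ≤ τ → ‖1 - f t‖ ≤ η := by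
    have : Tendsto (fun t => ‖1 - f t‖) (𝓝 0) (𝓝 0) := by
      have hc : Continuous fun t => ‖1 - f t‖ := by
        have := hf.continuous
        fun_prop
      simpa [hf.map_zero] using hc.tendsto 0
    obtain ⟨d, hd, hd'⟩ := Metric.eventually_nhds_iff.1 (this.eventually (gt_mem_nhds hη0))
    refine ⟨d / 2, by positivity, fun t ht => (hd' ?_).le⟩
    rw [Real.dist_0_eq_abs]
    linarith
  have hφc : ∀ n, Continuous fun t => laplaceTransform ν (ψ n t) := fun n =>
    (continuousOn_laplaceTransform hν).comp_continuous (hψ n).continuous (hψ n).re_nonneg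
  have hW : Tendsto (fun n => ∫ t in (-τ)..τ, (1 - laplaceTransform ν (ψ n t))) atTop
      (𝓝 (∫ t in (-τ)..τ, (1 - f t))) := by
    refine intervalIntegral.tendsto_integral_filter_of_dominated_convergence (fun _ => 2)
      (.of_forall fun n => ?_) (.of_forall fun n => ae_of_all _ fun t _ => ?_) (by simp)
      (ae_of_all _ fun t _ => (hlim t).const_sub 1)
    · exact (continuous_const.sub (hφc n)).aestronglyMeasurable
    · refine (norm_sub_le _ _).trans ?_
      have := norm_laplaceTransform_le_one hν ((hψ n).re_nonneg t)
      rw [norm_one]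
      linarith
  have hWf : ‖∫ t in (-τ)..τ, (1 - f t)‖ < 3 * τ * η := by
    have : ‖∫ t in (-τ)..τ, (1 - f t)‖ ≤ η * |τ - -τ| := by
      refine intervalIntegral.norm_integral_le_of_norm_le_const fun t ht => hτf t ?_
      rw [Set.uIoc_of_le (by linarith)] at ht
      exact abs_le.2 ⟨ht.1.le, ht.2⟩
    rw [sub_neg_eq_add, abs_of_pos (by linarith)] at this
    nlinarith
  have hmain : ∀ᶠ n in atTop, ∀ t, |t| ≤ e * τ / 6 → ‖ψ n t‖ ≤ ε := by
    filter_upwards [hW.norm.eventually (gt_mem_nhds hWf)] with n hn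
    obtain ⟨hwi, hw⟩ := integral_one_sub_laplaceTransform hν (hψ n) hτ.le
    set w : ℝ → ℂ := fun u => ∫ t in (-τ)..τ, (1 - Complex.exp (-(u * ψ n t))) with hwdef
    have hwim : ∀ u, 0 ≤ u → (w u).im = 0 := fun u hu =>
      im_integral_one_sub_eq_zero ((hψ n).isCharFun u hu) τ
    have hwre : ∀ u, 0 ≤ u → 0 ≤ (w u).re := by
      intro u hu
      have hχ := (hψ n).isCharFun u hu
      have hii : IntervalIntegrable (fun t => 1 - Complex.exp (-(u * ψ n t))) volume (-τ) τ :=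
        (continuous_const.sub hχ.continuous).intervalIntegrable _ _
      have h3 := Complex.reCLM.intervalIntegral_comp_comm hii
      simp only [Complex.reCLM_apply] at h3
      rw [hwdef]
      simp only
      rw [← h3]
      refine intervalIntegral.integral_nonneg (by linarith) fun t _ => ?_
      have := hχ.re_le_one t
      simp only [Complex.sub_re, Complex.one_re]
      linarith
    -- The average of the nonnegative `Re (w u)` over `ν` is small and `[u₀, ∞)` has mass `p`, so
    -- some time `u ≥ u₀` has small `w u`. One such time controls the whole exponent, since `ψ n`
    -- only gets divided by `u ≥ u₀`.
    obtain ⟨u, hu, hwu⟩ : ∃ u, u₀ ≤ u ∧ ‖w u‖ ≤ 4 * τ * η / p := by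
      by_contra! hcon
      have h1 : 4 * τ * η / p * p ≤ ∫ u in Set.Ici u₀, (w u).re ∂ν := by
        refine setIntegral_ge_of_const_le_real measurableSet_Ici (measure_ne_top _ _)
          (fun u hu => ?_) hwi.re.integrableOn
        have hu0 : 0 ≤ u := hu₀.le.trans hu
        refine (hcon u hu).le.trans (le_of_eq ?_)
        rw [← Complex.re_add_im (w u), hwim u hu0]
        simp [abs_of_nonneg (hwre u hu0)]
      have h2 : ∫ u in Set.Ici u₀, (w u).re ∂ν ≤ ∫ u, (w u).re ∂ν :=
        setIntegral_le_integral hwi.re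
          ((ae_nonneg_of_measure_Iio hν).mono fun u hu => hwre u hu)
      have h3 : ∫ u, (w u).re ∂ν = (∫ u, w u ∂ν).re := integral_re hwi
      have h4 := Complex.re_le_norm (∫ u, w u ∂ν)
      rw [← hw] at h4 h3
      rw [div_mul_cancel₀ _ hp0.ne'] at h1
      have : 0 < τ * η := by positivity
      linarith
    have hu0 : 0 < u := hu₀.trans_le hu
    have hchar : ∀ t, |t| ≤ e * τ / 6 → ‖1 - Complex.exp (-(u * ψ n t))‖ ≤ e := by
      intro t ht
      obtain ⟨P, hP, h⟩ := (hψ n).isCharFun u hu0.le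
      have h' : ∀ t, Complex.exp (-(u * ψ n t)) = charFun P t := h
      rw [h']
      have htr := measureReal_abs_gt_le_integral_charFun (μ := P) (r := 2 / τ) (by positivity)
      have h2τ : 2 * (2 / τ)⁻¹ = τ := by field_simp
      rw [neg_mul, h2τ] at htr
      simp_rw [← h'] at htr
      have h5 : P.real {x | 2 / τ < |x|} ≤ e / 3 := by
        refine htr.trans ?_
        calc 2⁻¹ * (2 / τ) * ‖w u‖ ≤ 2⁻¹ * (2 / τ) * (4 * τ * η / p) := by gcongr
          _ = e / 3 := by rw [hη]; field_simp; norm_num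
      refine (norm_one_sub_charFun_le P (r := 2 / τ) (by positivity) t).trans ?_
      have h6 : |t| * (2 / τ) ≤ e * τ / 6 * (2 / τ) := by gcongr
      have h7 : e * τ / 6 * (2 / τ) = e / 3 := by field_simp; norm_num
      linarith
    intro t ht
    have hψc := (hψ n).continuous
    have h8 := norm_le_of_norm_one_sub_exp_le (w := fun t => u * ψ n t) (by fun_prop)
      (by simp [(hψ n).map_zero]) he0 he1 hchar t ht
    rw [norm_mul, Complex.norm_real, Real.norm_of_nonneg hu0.le] at h8
    have h9 : e ≤ ε * u₀ / 2 := min_le_right _ _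
    have h10 : u * ‖ψ n t‖ ≤ u * ε := by nlinarith
    exact le_of_mul_le_mul_left h10 hu0
  obtain ⟨N, hN⟩ := eventually_atTop.1 hmain
  have hfin : ∀ᶠ t in 𝓝 (0 : ℝ), ∀ n ∈ Finset.range N, ‖ψ n t‖ ≤ ε := by
    rw [Filter.eventually_all_finset]
    intro n _
    have hc : Tendsto (fun t => ‖ψ n t‖) (𝓝 0) (𝓝 0) := by
      simpa [(hψ n).map_zero] using (hψ n).continuous.norm.tendsto 0
    exact (hc.eventually (gt_mem_nhds hε)).mono fun t ht => ht.le
  obtain ⟨d, hd, hd'⟩ := Metric.eventually_nhds_iff.1 hfin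
  refine ⟨min (d / 2) (e * τ / 6), by positivity, fun n t ht => ?_⟩
  by_cases hn : n < N
  · refine hd' ?_ n (Finset.mem_range.2 hn)
    rw [Real.dist_0_eq_abs]
    have := ht.trans (min_le_left _ _)
    linarith
  · exact hN n (not_lt.1 hn) t (ht.trans (min_le_right _ _))

end Tightness

/-! ### Rigidity of a Lévy process sampled at a random time. -/

/-- Two ordered random variables with the same law are almost surely equal. -/
lemma ae_eq_of_ae_le_of_map_eq {Ω : Type*} [MeasurableSpace Ω] {μ : Measure Ω}
    [IsProbabilityMeasure μ] {X Y : Ω → ℝ} (hX : Measurable X) (hY : Measurable Y)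
    (hle : X ≤ᵐ[μ] Y) (hmap : μ.map X = μ.map Y) : X =ᵐ[μ] Y := by
  -- `arctan` is bounded and strictly increasing, so the ordering can be tested by means without
  -- assuming integrability.
  have hi : ∀ {Z : Ω → ℝ}, Measurable Z → Integrable (fun x => Real.arctan (Z x)) μ :=
    fun {Z} hZ => Integrable.of_bound (by fun_prop) (Real.pi / 2) (ae_of_all _ fun x => by
      rw [Real.norm_eq_abs, abs_le]
      exact ⟨(Real.neg_pi_div_two_lt_arctan _).le, (Real.arctan_lt_pi_div_two _).le⟩)
  have hm : ∀ {Z : Ω → ℝ}, Measurable Z →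
      ∫ x, Real.arctan (Z x) ∂μ = ∫ y, Real.arctan y ∂(μ.map Z) := fun {Z} hZ => by
    rw [integral_map hZ.aemeasurable (by fun_prop)]
  have h0 : ∫ x, (Real.arctan (Y x) - Real.arctan (X x)) ∂μ = 0 := by
    rw [integral_sub (hi hY) (hi hX), hm hY, hm hX, hmap, sub_self]
  rw [integral_eq_zero_iff_of_nonneg_ae] at h0
  · filter_upwards [h0] with x hx
    exact (Real.arctan_injective (sub_eq_zero.1 hx)).symm
  · filter_upwards [hle] with x hx
    exact sub_nonneg.2 (Real.arctan_strictMono.monotone hx)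
  · exact (hi hY).sub (hi hX)

lemma lowerSemicontinuous_measure_of_continuous {q : ℝ → ProbabilityMeasure ℝ} (hq : Continuous q)
    {G : Set ℝ} (hG : IsOpen G) : LowerSemicontinuous fun u => (q u : Measure ℝ) G := by
  rw [lowerSemicontinuous_iff_le_liminf]
  intro u
  exact ProbabilityMeasure.le_liminf_measure_open_of_tendsto (hq.tendsto u) hG

lemma measurable_of_continuous_probabilityMeasure {q : ℝ → ProbabilityMeasure ℝ}
    (hq : Continuous q) : Measurable fun u => (q u : Measure ℝ) :=
  .measure_of_isPiSystem_of_isProbabilityMeasure (BorelSpace.measurable_eq (α := ℝ))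
    isPiSystem_isOpen fun _ hG => (lowerSemicontinuous_measure_of_continuous hq hG).measurable

namespace IsLevyExponent

variable {ψ : ℝ → ℂ}

/-- The convolution semigroup with exponent `ψ`, extended to be constant for negative times. -/
noncomputable def law (hψ : IsLevyExponent ψ) (u : ℝ) : ProbabilityMeasure ℝ :=
  ⟨(hψ.isCharFun (max u 0) (le_max_right _ _)).choose,
    (hψ.isCharFun (max u 0) (le_max_right _ _)).choose_spec.1⟩

lemma charFun_law_max (hψ : IsLevyExponent ψ) (u t : ℝ) :
    charFun (hψ.law u : Measure ℝ) t = Complex.exp (-((max u 0 : ℝ) * ψ t)) :=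
  ((hψ.isCharFun (max u 0) (le_max_right _ _)).choose_spec.2 t).symm

lemma charFun_law (hψ : IsLevyExponent ψ) {u : ℝ} (hu : 0 ≤ u) (t : ℝ) :
    charFun (hψ.law u : Measure ℝ) t = Complex.exp (-(u * ψ t)) := by
  rw [charFun_law_max, max_eq_left hu]

lemma continuous_law (hψ : IsLevyExponent ψ) : Continuous hψ.law := by
  refine SeqContinuous.continuous fun x p hx => ?_
  refine ProbabilityMeasure.tendsto_of_tendsto_charFun fun t => ?_
  simp only [Function.comp_apply, charFun_law_max]
  have : Continuous fun u : ℝ => Complex.exp (-((max u 0 : ℝ) * ψ t)) := by fun_prop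
  exact (this.tendsto p).comp hx

lemma law_add (hψ : IsLevyExponent ψ) {u v : ℝ} (hu : 0 ≤ u) (hv : 0 ≤ v) :
    (hψ.law (u + v) : Measure ℝ) = (hψ.law u : Measure ℝ).conv (hψ.law v) := by
  refine Measure.ext_of_charFun (funext fun t => ?_)
  rw [charFun_conv, charFun_law _ hu, charFun_law _ hv, charFun_law _ (add_nonneg hu hv),
    ← Complex.exp_add]
  congr 1
  push_cast
  ring

/-- The convolution semigroup as a Markov kernel. -/
noncomputable def kernel (hψ : IsLevyExponent ψ) : ProbabilityTheory.Kernel ℝ ℝ :=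
  ⟨fun u => (hψ.law u : Measure ℝ), measurable_of_continuous_probabilityMeasure hψ.continuous_law⟩

lemma kernel_apply (hψ : IsLevyExponent ψ) (u : ℝ) : hψ.kernel u = hψ.law u := rfl

instance (hψ : IsLevyExponent ψ) : ProbabilityTheory.IsMarkovKernel hψ.kernel :=
  ⟨fun u => inferInstanceAs (IsProbabilityMeasure (hψ.law u : Measure ℝ))⟩

open ProbabilityTheory

/-- The joint law of a random time with law `ν` and of the Lévy process with exponent `ψ` sampled
at that independent time. -/
noncomputable def jointLaw (hψ : IsLevyExponent ψ) (ν : Measure ℝ) : Measure (ℝ × ℝ) :=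
  ν.compProd hψ.kernel

variable {ν : Measure ℝ}

lemma ae_fst_nonneg (hψ : IsLevyExponent ψ) (hν : ν (Set.Iio 0) = 0) :
    ∀ᵐ p ∂(hψ.jointLaw ν), 0 ≤ p.1 := by
  refine Measure.ae_compProd_of_ae_ae (measurableSet_le measurable_const measurable_fst) ?_
  filter_upwards [ae_nonneg_of_measure_Iio hν] with u hu
  exact ae_of_all _ fun _ => hu

variable [IsProbabilityMeasure ν]

instance (hψ : IsLevyExponent ψ) : IsProbabilityMeasure (hψ.jointLaw ν) :=
  inferInstanceAs (IsProbabilityMeasure (ν.compProd hψ.kernel))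

lemma charFun_map_jointLaw (hψ : IsLevyExponent ψ) (hν : ν (Set.Iio 0) = 0) (c d t : ℝ) :
    charFun ((hψ.jointLaw ν).map fun p => c * p.2 + d * p.1) t =
      laplaceTransform ν (ψ (c * t) - Complex.I * d * t) := by
  rw [charFun_apply_real, integral_map (by fun_prop) (by fun_prop), jointLaw,
    Measure.integral_compProd, laplaceTransform]
  · refine integral_congr_ae ?_
    filter_upwards [ae_nonneg_of_measure_Iio hν] with u hu
    have : ∀ y : ℝ, Complex.exp (t * ((c * y + d * u : ℝ) : ℂ) * Complex.I) =
        Complex.exp (Complex.I * d * t * u) *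
          Complex.exp (((c * t : ℝ) : ℂ) * y * Complex.I) := fun y => by
      rw [← Complex.exp_add]
      congr 1
      push_cast
      ring
    simp only [this]
    rw [integral_const_mul, ← charFun_apply_real, kernel_apply, charFun_law _ hu,
      ← Complex.exp_add]
    congr 1
    ring
  · refine Integrable.of_bound (by fun_prop) 1 (ae_of_all _ fun p => ?_)
    rw [← Complex.ofReal_mul, Complex.norm_exp_ofReal_mul_I]

lemma map_jointLaw_eq (hψ : IsLevyExponent ψ) (hν : ν (Set.Iio 0) = 0) {c d : ℝ}
    (h : ∀ t : ℝ, laplaceTransform ν (ψ (c * t) + Complex.I * d * t) = laplaceTransform ν (ψ t)) :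
    (hψ.jointLaw ν).map Prod.snd = (hψ.jointLaw ν).map fun p => c * p.2 + -d * p.1 := by
  have h1 : (Prod.snd : ℝ × ℝ → ℝ) = fun p => 1 * p.2 + 0 * p.1 := by
    ext p; simp
  have : IsProbabilityMeasure ((hψ.jointLaw ν).map fun p => c * p.2 + -d * p.1) :=
    Measure.isProbabilityMeasure_map (by fun_prop)
  have : IsProbabilityMeasure ((hψ.jointLaw ν).map fun p => 1 * p.2 + 0 * p.1) :=
    Measure.isProbabilityMeasure_map (by fun_prop)
  rw [show (hψ.jointLaw ν).map Prod.snd = (hψ.jointLaw ν).map fun p => 1 * p.2 + 0 * p.1 from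
    congrArg (Measure.map · (hψ.jointLaw ν)) h1]
  refine Measure.ext_of_charFun (funext fun t => ?_)
  rw [charFun_map_jointLaw _ hν, charFun_map_jointLaw _ hν]
  simpa using (h t).symm

/-- Adding a nonzero multiple of the random time to the sampled process changes its law. -/
lemma eq_zero_of_laplaceTransform_add_eq (hψ : IsLevyExponent ψ) (hν : ν (Set.Iio 0) = 0)
    (hpos : ν (Set.Ioi 0) ≠ 0) {d : ℝ}
    (h : ∀ t : ℝ, laplaceTransform ν (ψ t + Complex.I * d * t) = laplaceTransform ν (ψ t)) :
    d = 0 := by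
  have hmap := hψ.map_jointLaw_eq hν (c := 1) (d := d) (by simpa using h)
  have hae : ∀ᵐ p ∂(hψ.jointLaw ν), d * p.1 = 0 := by
    rcases le_total d 0 with hd | hd
    · have := ae_eq_of_ae_le_of_map_eq (by fun_prop) (by fun_prop) (by
        filter_upwards [hψ.ae_fst_nonneg hν] with p hp
        nlinarith) hmap
      filter_upwards [this] with p hp
      linarith
    · have := ae_eq_of_ae_le_of_map_eq (by fun_prop) (by fun_prop) (by
        filter_upwards [hψ.ae_fst_nonneg hν] with p hp
        nlinarith) hmap.symm
      filter_upwards [this] with p hp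
      linarith
  by_contra hd
  refine hpos (measure_mono_null (t := {u : ℝ | ¬ (d * u = 0)}) (fun u hu => ?_) ?_)
  · exact mul_ne_zero hd (ne_of_gt hu)
  · rw [← ae_iff]
    filter_upwards [Measure.ae_ae_of_ae_compProd hae] with u hu
    exact eventually_const.1 hu

/-- Write `(T, X)` for the random time and the sampled value. Then `X` and `c X - d T` have the same
law. As `-d T ≥ 0` and `c < 1`, the second is strictly larger wherever `X < 0`. Truncation at `0`
orders the two everywhere, and equality in law then excludes `X < 0`. -/
lemma ae_law_Iio_eq_zero (hψ : IsLevyExponent ψ) (hν : ν (Set.Iio 0) = 0)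
    {c d : ℝ} (hc0 : 0 < c) (hc1 : c < 1) (hd : d ≤ 0)
    (h : ∀ t : ℝ, laplaceTransform ν (ψ (c * t) + Complex.I * d * t) = laplaceTransform ν (ψ t)) :
    ∀ᵐ u ∂ν, (hψ.law u : Measure ℝ) (Set.Iio 0) = 0 := by
  have hmap := hψ.map_jointLaw_eq hν h
  have hmin : (hψ.jointLaw ν).map (fun p => min p.2 0) =
      (hψ.jointLaw ν).map fun p => min (c * p.2 + -d * p.1) 0 := by
    have := congrArg (Measure.map fun x : ℝ => min x 0) hmap
    rwa [Measure.map_map (by fun_prop) (by fun_prop),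
      Measure.map_map (by fun_prop) (by fun_prop)] at this
  have hnn := hψ.ae_fst_nonneg hν
  have hae := ae_eq_of_ae_le_of_map_eq (by fun_prop) (by fun_prop) (by
    filter_upwards [hnn] with p hp
    have h1 : 0 ≤ -d * p.1 := mul_nonneg (by linarith) hp
    rcases le_total 0 p.2 with h2 | h2
    · have : 0 ≤ c * p.2 := by positivity
      rw [min_eq_right h2, min_eq_right (by linarith)]
    · rw [min_eq_left h2]
      exact le_min (by nlinarith) h2) hmin
  have hsnd : ∀ᵐ p ∂(hψ.jointLaw ν), 0 ≤ p.2 := by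
    filter_upwards [hae, hnn] with p hp hp1
    by_contra! hlt
    have h1 : 0 ≤ -d * p.1 := mul_nonneg (by linarith) hp1
    rw [min_eq_left hlt.le] at hp
    have : p.2 < min (c * p.2 + -d * p.1) 0 := lt_min (by nlinarith) hlt
    linarith
  filter_upwards [Measure.ae_ae_of_ae_compProd hsnd] with u hu
  rw [ae_iff] at hu
  simpa [kernel_apply, Set.Iio] using hu

end IsLevyExponent

lemma conv_Iio_zero_ge (μ ν : Measure ℝ) [SFinite μ] [SFinite ν] :
    μ (Set.Iio 0) * ν (Set.Iio 0) ≤ (μ.conv ν) (Set.Iio 0) := by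
  rw [Measure.conv, Measure.map_apply (by fun_prop) measurableSet_Iio, ← Measure.prod_prod]
  refine measure_mono fun p hp => ?_
  exact add_neg (Set.mem_Iio.1 hp.1) (Set.mem_Iio.1 hp.2)

lemma conv_Iio_zero_eq_zero {μ ν : Measure ℝ} [SFinite μ] [SFinite ν] (hμ : μ (Set.Iio 0) = 0)
    (hν : ν (Set.Iio 0) = 0) : (μ.conv ν) (Set.Iio 0) = 0 := by
  rw [Measure.conv, Measure.map_apply (by fun_prop) measurableSet_Iio]
  refine measure_mono_null (t := Set.Iio 0 ×ˢ Set.univ ∪ Set.univ ×ˢ Set.Iio 0) (fun p hp => ?_) ?_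
  · by_contra hcon
    simp only [Set.mem_union, Set.mem_prod, Set.mem_Iio, Set.mem_univ, and_true, true_and,
      not_or, not_lt] at hcon
    exact absurd (Set.mem_Iio.1 hp) (not_lt.2 (add_nonneg hcon.1 hcon.2))
  · rw [measure_union_null_iff, Measure.prod_prod, Measure.prod_prod, hμ, hν]
    simp

/-- Rounding `u` down to a multiple of `v / 2 ^ k` gives an error of at most `v / 2 ^ k`. -/
lemma mem_of_isClosed_of_forall_dyadic {S : Set ℝ} (hS : IsClosed S) {v : ℝ} (hv : 0 < v)
    (h : ∀ n k : ℕ, n * (v / 2 ^ k) ∈ S) {u : ℝ} (hu : 0 ≤ u) : u ∈ S := by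
  have hlim : Tendsto (fun k : ℕ => v / 2 ^ k) atTop (𝓝 0) := by
    have := (tendsto_pow_atTop_nhds_zero_of_lt_one (r := (1 / 2 : ℝ)) (by norm_num)
      (by norm_num)).const_mul v
    simpa [div_eq_mul_inv] using this
  refine hS.mem_of_tendsto (f := fun k : ℕ => (⌊u / (v / 2 ^ k)⌋₊ : ℝ) * (v / 2 ^ k)) (b := atTop) ?_
    (.of_forall fun k => h _ k)
  refine tendsto_of_tendsto_of_tendsto_of_le_of_le (g := fun k : ℕ => u - v / 2 ^ k)
    (h := fun _ => u) (by simpa using hlim.const_sub u) tendsto_const_nhds (fun k => ?_)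
    (fun k => ?_)
  · have hp : 0 < v / 2 ^ k := by positivity
    have := Nat.lt_floor_add_one (u / (v / 2 ^ k))
    rw [div_lt_iff₀ hp] at this
    simp only
    linarith
  · have hp : 0 < v / 2 ^ k := by positivity
    exact (le_div_iff₀ hp).1 (Nat.floor_le (by positivity))

/-- Continuous multiplicative functions on the half-line are exponentials. -/
lemma eq_exp_of_map_add_eq_mul {g : ℝ → ℝ} (hg : Continuous g) (hpos : ∀ u, 0 < g u)
    (hadd : ∀ u v, 0 ≤ u → 0 ≤ v → g (u + v) = g u * g v) {u : ℝ} (hu : 0 ≤ u) :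
    g u = Real.exp (u * Real.log (g 1)) := by
  have hlog : ∀ u v, 0 ≤ u → 0 ≤ v → Real.log (g (u + v)) = Real.log (g u) + Real.log (g v) :=
    fun u v hu hv => by rw [hadd u v hu hv, Real.log_mul (hpos u).ne' (hpos v).ne']
  have hnat : ∀ (n : ℕ) (v : ℝ), 0 ≤ v → Real.log (g (n * v)) = n * Real.log (g v) := by
    intro n v hv
    induction n with
    | zero =>
      have := hlog 0 0 le_rfl le_rfl
      simp only [add_zero, left_eq_add] at this
      simpa using this
    | succ n ih =>
      have : ((n + 1 : ℕ) : ℝ) * v = n * v + v := by push_cast; ring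
      rw [this, hlog _ _ (by positivity) hv, ih]
      push_cast
      ring
  have hmem : u ∈ {u | Real.log (g u) = u * Real.log (g 1)} := by
    refine mem_of_isClosed_of_forall_dyadic (v := 1) ?_ one_pos (fun n k => ?_) hu
    · exact isClosed_eq (hg.log fun u => (hpos u).ne') (by fun_prop)
    · have h2 := hnat (2 ^ k) (1 / 2 ^ k) (by positivity)
      have h3 : ((2 ^ k : ℕ) : ℝ) * (1 / 2 ^ k) = 1 := by
        push_cast
        field_simp
      rw [h3] at h2
      have h4 := hnat n (1 / 2 ^ k) (by positivity)
      simp only [Set.mem_ofPred_eq]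
      rw [h4, h2]
      push_cast
      field_simp
  rw [← hmem, Real.exp_log (hpos u)]

namespace IsLevyExponent

variable {ψ : ℝ → ℂ}

lemma law_zero (hψ : IsLevyExponent ψ) : (hψ.law 0 : Measure ℝ) = Measure.dirac 0 := by
  refine Measure.ext_of_charFun (funext fun t => ?_)
  rw [charFun_law _ le_rfl, charFun_dirac]
  simp

/-- Positivity passes to convolution square roots, since two independent negative values have a
negative sum, and to sums. The open set `Iio 0` has lower semicontinuous mass, so dyadic times
suffice. -/
lemma law_Iio_eq_zero_of_pos (hψ : IsLevyExponent ψ) {v : ℝ} (hv : 0 < v)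
    (h : (hψ.law v : Measure ℝ) (Set.Iio 0) = 0) {u : ℝ} (hu : 0 ≤ u) :
    (hψ.law u : Measure ℝ) (Set.Iio 0) = 0 := by
  have hhalf : ∀ k : ℕ, (hψ.law (v / 2 ^ k) : Measure ℝ) (Set.Iio 0) = 0 := by
    intro k
    induction k with
    | zero => simpa using h
    | succ k ih =>
      have h1 : v / 2 ^ k = v / 2 ^ (k + 1) + v / 2 ^ (k + 1) := by
        rw [pow_succ]
        field_simp
        norm_num
      rw [h1, hψ.law_add (by positivity) (by positivity)] at ih
      have := (conv_Iio_zero_ge _ _).trans ih.le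
      simpa using this
  have hmul : ∀ n k : ℕ, (hψ.law (n * (v / 2 ^ k)) : Measure ℝ) (Set.Iio 0) = 0 := by
    intro n k
    induction n with
    | zero => simp [law_zero]
    | succ n ih =>
      have h1 : ((n + 1 : ℕ) : ℝ) * (v / 2 ^ k) = n * (v / 2 ^ k) + v / 2 ^ k := by
        push_cast; ring
      rw [h1, hψ.law_add (by positivity) (by positivity)]
      exact conv_Iio_zero_eq_zero ih (hhalf k)
  have hcl : IsClosed {u | (hψ.law u : Measure ℝ) (Set.Iio 0) = 0} := by
    have := (lowerSemicontinuous_measure_of_continuous hψ.continuous_law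
      (isOpen_Iio (a := (0 : ℝ)))).isClosed_preimage 0
    convert! this using 1
    ext u
    simp
  exact mem_of_isClosed_of_forall_dyadic hcl hv hmul hu

/-- A convolution semigroup on the half-line has Laplace transforms `exp (-u η)`. -/
lemma exists_laplace_exponent (hψ : IsLevyExponent ψ)
    (h : ∀ u, 0 ≤ u → (hψ.law u : Measure ℝ) (Set.Iio 0) = 0) {s : ℝ} (hs : 0 ≤ s) :
    ∃ η : ℝ, 0 ≤ η ∧ ∀ u, 0 ≤ u →
      ∫ x, Real.exp (-(s * max x 0)) ∂(hψ.law u : Measure ℝ) = Real.exp (-(u * η)) := by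
  have hb : ∀ x : ℝ, ‖Real.exp (-(s * max x 0))‖ ≤ 1 := fun x => by
    rw [Real.norm_of_nonneg (Real.exp_pos _).le, Real.exp_le_one_iff]
    have := mul_nonneg hs (le_max_right x 0)
    linarith
  have hi : ∀ (P : Measure ℝ) [IsProbabilityMeasure P],
      Integrable (fun x : ℝ => Real.exp (-(s * max x 0))) P := fun P _ =>
    Integrable.of_bound (by fun_prop) 1 (ae_of_all _ hb)
  let g : ℝ → ℝ := fun u => ∫ x, Real.exp (-(s * max x 0)) ∂(hψ.law u : Measure ℝ)
  have hg : Continuous g := by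
    let F : BoundedContinuousFunction ℝ ℝ :=
      BoundedContinuousFunction.ofNormedAddCommGroup (fun x => Real.exp (-(s * max x 0)))
        (by fun_prop) 1 hb
    have := ProbabilityMeasure.continuous_iff_forall_continuous_integral.1 hψ.continuous_law F
    exact this
  have hpos : ∀ u, 0 < g u := fun u => integral_exp_pos (hi _)
  have hadd : ∀ u v, 0 ≤ u → 0 ≤ v → g (u + v) = g u * g v := by
    intro u v hu hv
    simp only [g]
    rw [hψ.law_add hu hv, integral_conv (hi _), ← integral_mul_const]
    refine integral_congr_ae ?_
    filter_upwards [ae_nonneg_of_measure_Iio (h u hu)] with x hx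
    rw [← integral_const_mul]
    refine integral_congr_ae ?_
    filter_upwards [ae_nonneg_of_measure_Iio (h v hv)] with y hy
    rw [max_eq_left hx, max_eq_left hy, max_eq_left (add_nonneg hx hy), ← Real.exp_add]
    congr 1
    ring
  refine ⟨-Real.log (g 1), ?_, fun u hu => ?_⟩
  · rw [neg_nonneg]
    refine Real.log_nonpos (hpos 1).le ?_
    calc g 1 ≤ ∫ _, (1 : ℝ) ∂(hψ.law 1 : Measure ℝ) :=
          integral_mono (hi _) (integrable_const 1) fun x => (le_abs_self _).trans (hb x)
      _ = 1 := by simp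
  · have := eq_exp_of_map_add_eq_mul hg hpos hadd hu
    simp only [mul_neg, neg_neg]
    exact this

variable {ν : Measure ℝ} [IsProbabilityMeasure ν]

/-- For a process on the half-line, real Laplace transforms of the sampled law are available; unlike
their complex counterparts they can be inverted by `integral_exp_neg_mul_inj`. -/
lemma integral_comp_mul_add_jointLaw (hψ : IsLevyExponent ψ) (hν : ν (Set.Iio 0) = 0)
    (h : ∀ u, 0 ≤ u → (hψ.law u : Measure ℝ) (Set.Iio 0) = 0) {s c b η : ℝ} (hs : 0 ≤ s)
    (hc : 0 ≤ c) (hb : 0 ≤ b) (hη : ∀ u, 0 ≤ u →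
      ∫ x, Real.exp (-(c * s * max x 0)) ∂(hψ.law u : Measure ℝ) = Real.exp (-(u * η))) :
    ∫ p, Real.exp (-(s * max (c * p.2 + b * p.1) 0)) ∂(hψ.jointLaw ν) =
      ∫ u, Real.exp (-((η + b * s) * u)) ∂ν := by
  rw [jointLaw, Measure.integral_compProd]
  · refine integral_congr_ae ?_
    filter_upwards [ae_nonneg_of_measure_Iio hν] with u hu
    have h1 : Real.exp (-((η + b * s) * u)) =
        Real.exp (-(b * s * u)) * Real.exp (-(u * η)) := by
      rw [← Real.exp_add]
      congr 1
      ring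
    rw [h1, ← hη u hu, ← integral_const_mul, kernel_apply]
    refine integral_congr_ae ?_
    filter_upwards [ae_nonneg_of_measure_Iio (h u hu)] with x hx
    rw [max_eq_left hx, max_eq_left (by positivity), ← Real.exp_add]
    congr 1
    ring
  · refine Integrable.of_bound (by fun_prop) 1 (ae_of_all _ fun p => ?_)
    rw [Real.norm_of_nonneg (Real.exp_pos _).le, Real.exp_le_one_iff]
    have := mul_nonneg hs (le_max_right (c * p.2 + b * p.1) 0)
    linarith

/-- The values at `s = 1` and `s = 2` already say that `exp(-X)` has variance zero. -/
lemma eq_I_mul_of_laplace (hψ : IsLevyExponent ψ)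
    (h : (hψ.law 1 : Measure ℝ) (Set.Iio 0) = 0) {b : ℝ}
    (hb : ∀ s : ℝ, 0 ≤ s →
      ∫ x, Real.exp (-(s * max x 0)) ∂(hψ.law 1 : Measure ℝ) = Real.exp (-(b * s))) (t : ℝ) :
    ψ t = Complex.I * (-b : ℝ) * t := by
  set P : Measure ℝ := (hψ.law 1 : Measure ℝ) with hP
  have hi : ∀ s : ℝ, 0 ≤ s → Integrable (fun x : ℝ => Real.exp (-(s * max x 0))) P :=
    fun s hs => Integrable.of_bound (by fun_prop) 1 (ae_of_all _ fun x => by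
      rw [Real.norm_of_nonneg (Real.exp_pos _).le, Real.exp_le_one_iff]
      have := mul_nonneg hs (le_max_right x 0)
      linarith)
  have hsq : ∀ x : ℝ, (Real.exp (-(1 * max x 0)) - Real.exp (-b)) ^ 2 =
      Real.exp (-(2 * max x 0)) - 2 * Real.exp (-b) * Real.exp (-(1 * max x 0))
        + Real.exp (-b) ^ 2 := fun x => by
    have : Real.exp (-(2 * max x 0)) = Real.exp (-(1 * max x 0)) ^ 2 := by
      rw [← Real.exp_nat_mul]
      congr 1
      push_cast
      ring
    rw [this]
    ring
  have hi2 : Integrable (fun x : ℝ => Real.exp (-(2 * max x 0)) -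
      2 * Real.exp (-b) * Real.exp (-(1 * max x 0))) P :=
    (hi 2 (by norm_num)).sub ((hi 1 (by norm_num)).const_mul _)
  have h0 : ∫ x, (Real.exp (-(1 * max x 0)) - Real.exp (-b)) ^ 2 ∂P = 0 := by
    simp_rw [hsq]
    rw [integral_add hi2 (integrable_const _), integral_sub (hi 2 (by norm_num))
      ((hi 1 (by norm_num)).const_mul _), integral_const_mul, hb 2 (by norm_num),
      hb 1 (by norm_num)]
    have : Real.exp (-(b * 2)) = Real.exp (-b) ^ 2 := by
      rw [← Real.exp_nat_mul]
      congr 1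
      push_cast
      ring
    rw [this]
    simp
    ring
  have hae : ∀ᵐ x ∂P, x = b := by
    rw [integral_eq_zero_iff_of_nonneg (fun x => sq_nonneg _) (by
      simp_rw [hsq]
      exact hi2.add (integrable_const _))] at h0
    filter_upwards [h0, ae_nonneg_of_measure_Iio h] with x hx hx0
    have h1 := Real.exp_injective (sub_eq_zero.1 (pow_eq_zero_iff two_ne_zero |>.1 hx))
    rw [max_eq_left hx0] at h1
    linarith
  have hchar : ∀ t, Complex.exp (-ψ t) = Complex.exp (Complex.I * b * t) := by
    intro t
    have h1 := hψ.charFun_law zero_le_one t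
    rw [Complex.ofReal_one, one_mul] at h1
    rw [← h1, charFun_apply_real, integral_congr_ae (g := fun _ => Complex.exp (Complex.I * b * t))]
    · simp
    · filter_upwards [hae] with x hx
      rw [hx]
      congr 1
      ring
  have := eq_of_exp_eq (u := fun t => -ψ t) (v := fun t : ℝ => Complex.I * b * t)
    hψ.continuous.neg (by fun_prop) (by simp [hψ.map_zero]) hchar t
  rw [← neg_neg (ψ t), this]
  push_cast
  ring

lemma eq_I_mul_of_laplaceTransform_eq_of_nonpos (hψ : IsLevyExponent ψ)
    (hν : ν (Set.Iio 0) = 0) (hpos : ν (Set.Ioi 0) ≠ 0) {c d : ℝ} (hc0 : 0 < c) (hc1 : c < 1)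
    (hd : d ≤ 0)
    (h : ∀ t : ℝ, laplaceTransform ν (ψ (c * t) + Complex.I * d * t) = laplaceTransform ν (ψ t)) :
    ∃ b : ℝ, ∀ t : ℝ, ψ t = Complex.I * b * t := by
  obtain ⟨v, hv, hv0⟩ : ∃ v : ℝ, 0 < v ∧ (hψ.law v : Measure ℝ) (Set.Iio 0) = 0 := by
    by_contra! hcon
    have hae := hψ.ae_law_Iio_eq_zero hν hc0 hc1 hd h
    exact hpos (measure_mono_null (fun u hu => hcon u hu) (ae_iff.1 hae))
  have hlaw : ∀ u, 0 ≤ u → (hψ.law u : Measure ℝ) (Set.Iio 0) = 0 := fun u hu =>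
    hψ.law_Iio_eq_zero_of_pos hv hv0 hu
  have hmap := hψ.map_jointLaw_eq hν h
  choose! η hη0 hη using fun s (hs : 0 ≤ s) => hψ.exists_laplace_exponent hlaw hs
  -- Injectivity on the real axis turns equality of the sampled laws into a functional equation for
  -- the Laplace exponent.
  have hfun : ∀ s, 0 ≤ s → η s = η (c * s) + -d * s := by
    intro s hs
    have h1 := congrArg (fun μ : Measure ℝ => ∫ x, Real.exp (-(s * max x 0)) ∂μ) hmap
    rw [integral_map (by fun_prop) (by fun_prop), integral_map (by fun_prop) (by fun_prop)] at h1
    have h2 := hψ.integral_comp_mul_add_jointLaw hν hlaw (c := 1) (b := 0) (η := η s) hs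
      zero_le_one le_rfl (by simpa using hη s hs)
    have h3 := hψ.integral_comp_mul_add_jointLaw hν hlaw (c := c) (b := -d) (η := η (c * s)) hs
      hc0.le (by linarith) (hη (c * s) (by positivity))
    simp only [one_mul, zero_mul, add_zero] at h2
    rw [h2, h3] at h1
    have hds : 0 ≤ -d * s := mul_nonneg (by linarith) hs
    exact integral_exp_neg_mul_inj hν hpos (hη0 s hs)
      (add_nonneg (hη0 _ (by positivity)) hds) h1
  -- The slope of the linear solution of `hfun`. The remainder `η s - b s` is invariant under `s ↦ c
  -- s` and tends to `0` at `0`, so it vanishes.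
  set b : ℝ := -d / (1 - c) with hbdef
  have hb : b * (1 - c) = -d := div_mul_cancel₀ _ (by linarith)
  have hiter : ∀ s, 0 ≤ s → ∀ k : ℕ, η (c ^ k * s) - b * (c ^ k * s) = η s - b * s := by
    intro s hs k
    induction k with
    | zero => simp
    | succ k ih =>
      have h1 := hfun (c ^ k * s) (by positivity)
      rw [← hb] at h1
      rw [← ih, h1, pow_succ', mul_assoc c]
      ring
  have hηb : ∀ s, 0 ≤ s → η s = b * s := by
    intro s hs
    have hpow : Tendsto (fun k : ℕ => c ^ k * s) atTop (𝓝 0) := by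
      simpa using (tendsto_pow_atTop_nhds_zero_of_lt_one hc0.le hc1).mul_const s
    have hL : Tendsto (fun k : ℕ => ∫ x, Real.exp (-(c ^ k * s * max x 0))
        ∂(hψ.law 1 : Measure ℝ)) atTop (𝓝 (∫ _, (1 : ℝ) ∂(hψ.law 1 : Measure ℝ))) := by
      refine tendsto_integral_of_dominated_convergence (fun _ => 1) (fun k => by fun_prop)
        (integrable_const 1) (fun k => ae_of_all _ fun x => ?_) (ae_of_all _ fun x => ?_)
      · rw [Real.norm_of_nonneg (Real.exp_pos _).le, Real.exp_le_one_iff]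
        have : 0 ≤ c ^ k * s * max x 0 := mul_nonneg (by positivity) (le_max_right _ _)
        linarith
      · have := (Real.continuous_exp.tendsto _).comp ((hpow.mul_const (max x 0)).neg)
        simpa [Function.comp_def] using this
    have h1 : ∀ k : ℕ, ∫ x, Real.exp (-(c ^ k * s * max x 0)) ∂(hψ.law 1 : Measure ℝ) =
        Real.exp (-η (c ^ k * s)) := fun k => by
      rw [hη _ (by positivity) 1 zero_le_one, one_mul]
    simp_rw [h1] at hL
    have h2 := hL.log (by simp)
    simp only [Real.log_exp, integral_const, probReal_univ, smul_eq_mul, mul_one,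
      Real.log_one] at h2
    have h3 : Tendsto (fun k : ℕ => η (c ^ k * s) - b * (c ^ k * s)) atTop (𝓝 0) := by
      simpa using h2.neg.sub (hpow.const_mul b)
    simp_rw [hiter s hs] at h3
    exact sub_eq_zero.1 (tendsto_nhds_unique tendsto_const_nhds h3)
  refine ⟨-b, hψ.eq_I_mul_of_laplace (hlaw 1 zero_le_one) fun s hs => ?_⟩
  rw [hη s hs 1 zero_le_one, hηb s hs, one_mul]

/-- If a contraction of the sampled process, compensated by a multiple of the random time, has the
law of the sampled process, then the process is a deterministic drift. -/
lemma eq_I_mul_of_laplaceTransform_eq (hψ : IsLevyExponent ψ)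
    (hν : ν (Set.Iio 0) = 0) (hpos : ν (Set.Ioi 0) ≠ 0) {c d : ℝ} (hc0 : 0 < c) (hc1 : c < 1)
    (h : ∀ t : ℝ, laplaceTransform ν (ψ (c * t) + Complex.I * d * t) = laplaceTransform ν (ψ t)) :
    ∃ b : ℝ, ∀ t : ℝ, ψ t = Complex.I * b * t := by
  rcases le_total d 0 with hd | hd
  · exact hψ.eq_I_mul_of_laplaceTransform_eq_of_nonpos hν hpos hc0 hc1 hd h
  · obtain ⟨b, hb⟩ := hψ.comp_neg.eq_I_mul_of_laplaceTransform_eq_of_nonpos hν hpos hc0 hc1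
      (d := -d) (by linarith) fun t => by simpa using h (-t)
    refine ⟨-b, fun t => ?_⟩
    have := hb (-t)
    rw [neg_neg] at this
    rw [this]
    push_cast
    ring

end IsLevyExponent

/-! ### Equicontinuous families of exponents. -/

/-- A family of exponents which is locally bounded and locally uniformly equicontinuous. -/
structure IsEquicontinuousExponents (ψ : ℕ → ℝ → ℂ) : Prop where
  isLevyExponent : ∀ n, IsLevyExponent (ψ n)
  bounded : ∀ T : ℝ, ∃ B : ℝ, ∀ n t, |t| ≤ T → ‖ψ n t‖ ≤ B
  equicontinuous : ∀ T : ℝ, ∀ ε > 0, ∃ δ > 0, ∀ n s t, |s| ≤ T → |t| ≤ δ →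
    ‖ψ n (s + t) - ψ n s‖ ≤ ε

namespace IsEquicontinuousExponents

variable {ψ : ℕ → ℝ → ℂ}

lemma comp (h : IsEquicontinuousExponents ψ) (p : ℕ → ℕ) :
    IsEquicontinuousExponents fun n => ψ (p n) where
  isLevyExponent n := h.isLevyExponent _
  bounded T := (h.bounded T).imp fun _ hB n => hB (p n)
  equicontinuous T ε hε := by
    obtain ⟨δ, hδ, hd⟩ := h.equicontinuous T ε hε
    exact ⟨δ, hδ, fun n => hd (p n)⟩

/-- With `s = t` the increment bound gives `‖ψ n (2t)‖ ≤ 4 ‖ψ n t‖`, which spreads boundedness from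
a neighbourhood of `0`. With `s` bounded and `t` small it gives equicontinuity. -/
lemma of_increments (hψ : ∀ n, IsLevyExponent (ψ n))
    (hinc : ∀ n s t, ‖ψ n (s + t) - ψ n s - ψ n t‖ ^ 2 ≤ 4 * (‖ψ n s‖ * ‖ψ n t‖))
    (h0 : ∀ ε > 0, ∃ δ > 0, ∀ n t, |t| ≤ δ → ‖ψ n t‖ ≤ ε) : IsEquicontinuousExponents ψ := by
  have hbdd : ∀ T : ℝ, ∃ B : ℝ, ∀ n t, |t| ≤ T → ‖ψ n t‖ ≤ B := by
    obtain ⟨δ, hδ, h1⟩ := h0 1 one_pos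
    have hdouble : ∀ n t, ‖ψ n (2 * t)‖ ≤ 4 * ‖ψ n t‖ := by
      intro n t
      have h2 := hinc n t t
      have h3 : ‖ψ n (t + t) - ψ n t - ψ n t‖ ≤ 2 * ‖ψ n t‖ :=
        le_of_sq_le_sq (by nlinarith) (by positivity)
      have h4 : ‖ψ n (2 * t)‖ ≤ ‖ψ n (t + t) - ψ n t - ψ n t‖ + ‖ψ n t‖ + ‖ψ n t‖ := by
        rw [two_mul]
        calc _ = ‖(ψ n (t + t) - ψ n t - ψ n t) + ψ n t + ψ n t‖ := by congr 1; ring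
          _ ≤ _ := (norm_add_le _ _).trans (by gcongr; exact norm_add_le _ _)
      linarith
    have hk : ∀ k : ℕ, ∀ n t, |t| ≤ 2 ^ k * δ → ‖ψ n t‖ ≤ 4 ^ k := by
      intro k
      induction k with
      | zero => simpa using h1
      | succ k ih =>
        intro n t ht
        have h5 := hdouble n (t / 2)
        rw [mul_div_cancel₀ _ two_ne_zero] at h5
        have h6 := ih n (t / 2) (by
          rw [abs_div, abs_two, div_le_iff₀ two_pos]
          refine ht.trans (le_of_eq ?_)
          ring)
        rw [pow_succ]
        linarith
    intro T
    obtain ⟨k, hk'⟩ := pow_unbounded_of_one_lt (T / δ) (one_lt_two)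
    refine ⟨4 ^ k, fun n t ht => hk k n t (ht.trans ?_)⟩
    rw [div_lt_iff₀ hδ] at hk'
    exact hk'.le
  refine ⟨hψ, hbdd, fun T ε hε => ?_⟩
  obtain ⟨B, hB⟩ := hbdd T
  have hB' : 0 < |B| + 1 := by positivity
  obtain ⟨δ, hδ, h1⟩ := h0 (min (ε / 2) (ε ^ 2 / (16 * (|B| + 1))))
    (lt_min (by positivity) (by positivity))
  refine ⟨δ, hδ, fun n s t hs ht => ?_⟩
  have h2 := (h1 n t ht).trans (min_le_left _ _)
  have h3 := (h1 n t ht).trans (min_le_right _ _)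
  have h4 : ‖ψ n (s + t) - ψ n s - ψ n t‖ ≤ ε / 2 := by
    refine le_of_sq_le_sq ((hinc n s t).trans ?_) (by positivity)
    have h5 : ‖ψ n s‖ ≤ |B| + 1 := (hB n s hs).trans (by linarith [le_abs_self B])
    calc 4 * (‖ψ n s‖ * ‖ψ n t‖) ≤ 4 * ((|B| + 1) * (ε ^ 2 / (16 * (|B| + 1)))) := by gcongr
      _ = (ε / 2) ^ 2 := by field_simp; norm_num
  calc ‖ψ n (s + t) - ψ n s‖ = ‖(ψ n (s + t) - ψ n s - ψ n t) + ψ n t‖ := by congr 1; ring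
    _ ≤ ε / 2 + ε / 2 := (norm_add_le _ _).trans (add_le_add h4 h2)
    _ = ε := by ring

lemma tendsto_comp (h : IsEquicontinuousExponents ψ) {U : Filter ℕ} {Ψ : ℝ → ℂ}
    (hΨ : ∀ t, Tendsto (fun n => ψ n t) U (𝓝 (Ψ t))) {x : ℕ → ℝ} {y : ℝ}
    (hx : Tendsto x U (𝓝 y)) : Tendsto (fun n => ψ n (x n)) U (𝓝 (Ψ y)) := by
  have hz : Tendsto (fun n => ψ n (x n) - ψ n y) U (𝓝 0) := by
    rw [Metric.tendsto_nhds]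
    intro ε hε
    obtain ⟨δ, hδ, hd⟩ := h.equicontinuous |y| (ε / 2) (by positivity)
    filter_upwards [hx.eventually (Metric.ball_mem_nhds y hδ)] with n hn
    have := hd n y (x n - y) le_rfl (by simpa [Real.dist_eq] using (Metric.mem_ball.1 hn).le)
    rw [add_sub_cancel] at this
    rw [dist_zero_right]
    linarith
  simpa using hz.add (hΨ y)

/-- Along an ultrafilter, an equicontinuous family of exponents converges to an exponent. -/
lemma exists_tendsto (h : IsEquicontinuousExponents ψ) (U : Ultrafilter ℕ) :
    ∃ Ψ : ℝ → ℂ, IsLevyExponent Ψ ∧ ∀ t, Tendsto (fun n => ψ n t) U (𝓝 (Ψ t)) := by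
  have hex : ∀ t, ∃ l, Tendsto (fun n => ψ n t) U (𝓝 l) := by
    intro t
    obtain ⟨B, hB⟩ := h.bounded |t|
    obtain ⟨l, -, hl⟩ := (isCompact_closedBall (0 : ℂ) B).ultrafilter_le_nhds
      (U.map fun n => ψ n t) (by
        rw [le_principal_iff]
        exact Filter.mem_map.2 (Filter.univ_mem' fun n => by simpa using hB n t le_rfl))
    exact ⟨l, hl⟩
  choose Ψ hΨ using hex
  refine ⟨Ψ, ⟨?_, ?_, fun u hu => ?_⟩, hΨ⟩
  · rw [Metric.continuous_iff]
    intro s ε hε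
    obtain ⟨δ, hδ, hd⟩ := h.equicontinuous |s| (ε / 2) (by positivity)
    refine ⟨δ, hδ, fun t ht => ?_⟩
    have h1 : ∀ n, ‖ψ n t - ψ n s‖ ≤ ε / 2 := fun n => by
      have := hd n s (t - s) le_rfl (by simpa [Real.dist_eq] using ht.le)
      rwa [add_sub_cancel] at this
    have h2 := le_of_tendsto' ((hΨ t).sub (hΨ s)).norm h1
    rw [dist_eq_norm]
    linarith
  · refine tendsto_nhds_unique (hΨ 0) ?_
    simp [(h.isLevyExponent _).map_zero]
  · refine IsCharFun.of_tendsto_ultrafilter (U := U)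
      (fun n => (h.isLevyExponent n).isCharFun u hu) (fun ε hε => ?_) fun t => ?_
    · obtain ⟨δ, hδ, hd⟩ := h.equicontinuous 0 (min (1 / (u + 1)) (ε / (2 * (u + 1))))
        (lt_min (by positivity) (by positivity))
      refine ⟨δ, hδ, fun n t ht => ?_⟩
      have h1 := hd n 0 t (by simp) ht
      rw [zero_add, (h.isLevyExponent n).map_zero, sub_zero] at h1
      have hu1 : 0 < u + 1 := by linarith
      have h2 : ‖-(u * ψ n t)‖ ≤ 1 := by
        rw [norm_neg, norm_mul, Complex.norm_real, Real.norm_of_nonneg hu]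
        have := h1.trans (min_le_left _ _)
        rw [le_div_iff₀ hu1] at this
        nlinarith [norm_nonneg (ψ n t)]
      have h3 : ‖-(u * ψ n t)‖ ≤ ε / 2 := by
        rw [norm_neg, norm_mul, Complex.norm_real, Real.norm_of_nonneg hu]
        have := h1.trans (min_le_right _ _)
        rw [le_div_iff₀ (by positivity)] at this
        nlinarith [norm_nonneg (ψ n t)]
      have h4 := Complex.norm_exp_sub_one_le h2
      rw [norm_sub_rev]
      linarith
    · exact (Complex.continuous_exp.tendsto _).comp ((hΨ t).const_mul (u : ℂ)).neg

end IsEquicontinuousExponents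

/-! ### Accompanying exponents and convergence of types. -/

/-- The exponents `n (1 - h (t / a n)) + i t μ n`. -/
noncomputable def accompanyingExponent (h : ℝ → ℂ) (a μ : ℕ → ℝ) (n : ℕ) (t : ℝ) : ℂ :=
  (n : ℂ) * (1 - h (t / a n)) + Complex.I * (t : ℂ) * (μ n : ℂ)

section Accompanying

variable {h : ℝ → ℂ} {a μ : ℕ → ℝ}

lemma isLevyExponent_accompanyingExponent (hh : IsCharFun h) (a μ : ℕ → ℝ) (n : ℕ) :
    IsLevyExponent (accompanyingExponent h a μ n) := by
  have := IsLevyExponent.compoundPoisson hh n.cast_nonneg (a n) (μ n)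
  simp only [Complex.ofReal_natCast] at this
  exact this

lemma norm_accompanyingExponent_add_sub_sub_sq_le (hh : IsCharFun h) (a μ : ℕ → ℝ) (n : ℕ)
    (s t : ℝ) :
    ‖accompanyingExponent h a μ n (s + t) - accompanyingExponent h a μ n s -
      accompanyingExponent h a μ n t‖ ^ 2 ≤
      4 * (‖accompanyingExponent h a μ n s‖ * ‖accompanyingExponent h a μ n t‖) := by
  have h1 : accompanyingExponent h a μ n (s + t) - accompanyingExponent h a μ n s -
      accompanyingExponent h a μ n t =
      n * ((1 - h (s / a n + t / a n)) - (1 - h (s / a n)) - (1 - h (t / a n))) := by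
    simp only [accompanyingExponent, add_div]
    push_cast
    ring
  have h2 : ∀ t, (n : ℝ) * (1 - h (t / a n)).re ≤ ‖accompanyingExponent h a μ n t‖ := by
    intro t
    refine le_trans (le_of_eq ?_) (Complex.re_le_norm _)
    simp [accompanyingExponent]
  have h3 : ∀ t, 0 ≤ (n : ℝ) * (1 - h (t / a n)).re := fun t => by
    have := hh.re_le_one (t / a n)
    simp only [Complex.sub_re, Complex.one_re]
    exact mul_nonneg n.cast_nonneg (by linarith)
  rw [h1, norm_mul, mul_pow, Complex.norm_natCast]
  calc _ ≤ (n : ℝ) ^ 2 * (4 * ((1 - h (s / a n)).re * (1 - h (t / a n)).re)) := by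
        gcongr
        exact hh.norm_add_sub_sub_sq_le _ _
    _ = 4 * ((n * (1 - h (s / a n)).re) * (n * (1 - h (t / a n)).re)) := by ring
    _ ≤ _ := by
        gcongr
        · exact h3 t
        · exact h2 s
        · exact h2 t

/-- Convergence of types: two limits of the accompanying exponents along different subsequences
are of the same type. -/
lemma eq_of_tendsto_accompanyingExponent (ha : ∀ n, 0 < a n) {U : Filter ℕ} [U.NeBot]
    {p q : ℕ → ℕ} (hp : ∀ᶠ n in U, p n ≠ 0)
    (hE : IsEquicontinuousExponents (accompanyingExponent h a μ)) {Ψp Ψq : ℝ → ℂ}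
    (hΨp : ∀ t, Tendsto (fun n => accompanyingExponent h a μ (p n) t) U (𝓝 (Ψp t)))
    (hΨq : ∀ t, Tendsto (fun n => accompanyingExponent h a μ (q n) t) U (𝓝 (Ψq t)))
    {l c : ℝ} (hl : Tendsto (fun n => (q n : ℝ) / p n) U (𝓝 l))
    (hc : Tendsto (fun n => a (p n) / a (q n)) U (𝓝 c)) :
    ∃ D : ℝ, ((∀ n, μ n = 0) → D = 0) ∧ ∀ t : ℝ, Ψq t = l * Ψp (c * t) + Complex.I * D * t := by
  -- After rescaling, the compound Poisson parts cancel exactly and only this drift remains. Its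
  -- convergence is read off at `t = 1`.
  let δ : ℕ → ℝ := fun n => μ (q n) - (q n : ℝ) / p n * (a (p n) / a (q n)) * μ (p n)
  have hid : ∀ t : ℝ, ∀ᶠ n in U, accompanyingExponent h a μ (q n) t -
      (((q n : ℝ) / p n : ℝ) : ℂ) * accompanyingExponent h a μ (p n) (a (p n) / a (q n) * t) =
      Complex.I * (δ n : ℂ) * t := by
    intro t
    filter_upwards [hp] with n hn
    have h1 : a (p n) / a (q n) * t / a (p n) = t / a (q n) := by
      have := (ha (p n)).ne'
      field_simp
    have hn' : (p n : ℂ) ≠ 0 := by exact_mod_cast hn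
    simp only [accompanyingExponent, h1, δ]
    push_cast
    field_simp
    ring
  have hlim : ∀ t : ℝ, Tendsto (fun n => Complex.I * (δ n : ℂ) * t) U
      (𝓝 (Ψq t - l * Ψp (c * t))) := by
    intro t
    have h2 := (hE.comp p).tendsto_comp hΨp (hc.mul_const t)
    have h3 := (Complex.continuous_ofReal.tendsto l).comp hl
    exact ((hΨq t).sub (h3.mul h2)).congr' (hid t)
  set w := Ψq 1 - l * Ψp (c * 1) with hw
  have hδ : Tendsto δ U (𝓝 w.im) := by
    have h1 := hlim (1 : ℝ)
    have := (Complex.continuous_im.tendsto _).comp h1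
    simpa [Function.comp_def, hw] using this
  refine ⟨w.im, fun hμ => ?_, fun t => ?_⟩
  · refine tendsto_nhds_unique hδ ?_
    simp [δ, hμ]
  · have h4 : Tendsto (fun n => Complex.I * (δ n : ℂ) * t) U (𝓝 (Complex.I * w.im * t)) :=
      (((Complex.continuous_ofReal.tendsto _).comp hδ).const_mul _).mul_const _
    have := tendsto_nhds_unique (hlim t) h4
    rw [← this]
    ring

end Accompanying

/-! ### From the limit to stability. -/

section Representation

variable {ν : Measure ℝ} [IsProbabilityMeasure ν] {f h : ℝ → ℂ} {a μ : ℕ → ℝ}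

lemma isEquicontinuousExponents_accompanyingExponent (hν : ν (Set.Iio 0) = 0)
    (hpos : ν (Set.Ioi 0) ≠ 0) (hf : IsCharFun f) (hh : IsCharFun h)
    (hlim : ∀ t, Tendsto (fun n => laplaceTransform ν (accompanyingExponent h a μ n t)) atTop
      (𝓝 (f t))) : IsEquicontinuousExponents (accompanyingExponent h a μ) :=
  .of_increments (isLevyExponent_accompanyingExponent hh a μ)
    (norm_accompanyingExponent_add_sub_sub_sq_le hh a μ) fun _ hε =>
    exists_forall_norm_le_of_tendsto_laplaceTransform hν hpos
      (isLevyExponent_accompanyingExponent hh a μ) hf hlim hε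

lemma laplaceTransform_eq_of_tendsto (hν : ν (Set.Iio 0) = 0) {ψ : ℕ → ℝ → ℂ}
    (hψ : ∀ n, IsLevyExponent (ψ n))
    (hlim : ∀ t, Tendsto (fun n => laplaceTransform ν (ψ n t)) atTop (𝓝 (f t)))
    {U : Filter ℕ} [U.NeBot] {p : ℕ → ℕ} (hp : Tendsto p U atTop) {Ψ : ℝ → ℂ}
    (hΨ : ∀ t, Tendsto (fun n => ψ (p n) t) U (𝓝 (Ψ t))) (t : ℝ) :
    f t = laplaceTransform ν (Ψ t) := by
  have hcl : IsClosed {z : ℂ | 0 ≤ z.re} := isClosed_le continuous_const Complex.continuous_re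
  have hmem : ∀ᶠ n in U, ψ (p n) t ∈ {z : ℂ | 0 ≤ z.re} :=
    .of_forall fun n => (hψ _).re_nonneg t
  have h0 : Ψ t ∈ {z : ℂ | 0 ≤ z.re} := hcl.mem_of_tendsto (hΨ t) hmem
  exact tendsto_nhds_unique ((hlim t).comp hp)
    ((continuousOn_laplaceTransform hν _ h0).tendsto.comp (tendsto_nhdsWithin_iff.2 ⟨hΨ t, hmem⟩))

/-- Bounded ratios of normings have a limit along an ultrafilter, up to exchanging the roles. -/
lemma exists_tendsto_div (ha : ∀ n, 0 < a n) (U : Ultrafilter ℕ) (p q : ℕ → ℕ) :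
    ∃ c : ℝ, 0 ≤ c ∧ c ≤ 1 ∧ (Tendsto (fun n => a (p n) / a (q n)) U (𝓝 c) ∨
      Tendsto (fun n => a (q n) / a (p n)) U (𝓝 c)) := by
  have key : ∀ p q : ℕ → ℕ, (∀ᶠ n in U, a (p n) ≤ a (q n)) →
      ∃ c : ℝ, 0 ≤ c ∧ c ≤ 1 ∧ Tendsto (fun n => a (p n) / a (q n)) U (𝓝 c) := by
    intro p q hpq
    obtain ⟨c, hc, hlim⟩ := (isCompact_Icc (a := (0 : ℝ)) (b := 1)).ultrafilter_le_nhds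
      (U.map fun n => a (p n) / a (q n)) (by
        rw [le_principal_iff]
        refine Filter.mem_map.2 ?_
        filter_upwards [hpq] with n hn
        exact ⟨(div_pos (ha _) (ha _)).le, (div_le_one (ha _)).2 hn⟩)
    exact ⟨c, hc.1, hc.2, hlim⟩
  rcases Ultrafilter.em U (fun n => a (p n) ≤ a (q n)) with hU | hU
  · obtain ⟨c, h0, h1, hc⟩ := key p q hU
    exact ⟨c, h0, h1, .inl hc⟩
  · obtain ⟨c, h0, h1, hc⟩ := key q p (hU.mono fun n hn => (not_le.1 hn).le)
    exact ⟨c, h0, h1, .inr hc⟩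

/-- Three cases: `c = 0` leaves a pure drift, `0 < c < 1` forces one by rigidity, and `c = 1` allows
no drift `D`. The first two contradict `hdeg`. -/
lemma eq_of_eq_comp_mul_add (hν : ν (Set.Iio 0) = 0) (hpos : ν (Set.Ioi 0) ≠ 0)
    (hdeg : ¬ ∃ b : ℝ, ∀ t : ℝ, f t = laplaceTransform ν (Complex.I * b * t))
    {Ψ Ψ' : ℝ → ℂ} (hΨ : IsLevyExponent Ψ) (hf : ∀ t, f t = laplaceTransform ν (Ψ t))
    (hf' : ∀ t, f t = laplaceTransform ν (Ψ' t)) {c D : ℝ} (hc0 : 0 ≤ c) (hc1 : c ≤ 1)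
    (h : ∀ t : ℝ, Ψ' t = Ψ (c * t) + Complex.I * D * t) (t : ℝ) : Ψ' t = Ψ t := by
  have hφ : ∀ t : ℝ, laplaceTransform ν (Ψ (c * t) + Complex.I * D * t) =
      laplaceTransform ν (Ψ t) := fun t => by rw [← h, ← hf, ← hf']
  rcases hc0.eq_or_lt with rfl | hc0
  · refine absurd ⟨D, fun t => ?_⟩ hdeg
    rw [hf', h, zero_mul, hΨ.map_zero, zero_add]
  rcases hc1.eq_or_lt with rfl | hc1
  · have := hΨ.eq_zero_of_laplaceTransform_add_eq hν hpos (by simpa using hφ)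
    rw [h, this]
    simp
  · obtain ⟨b, hb⟩ := hΨ.eq_I_mul_of_laplaceTransform_eq hν hpos hc0 hc1 hφ
    exact absurd ⟨b, fun t => by rw [hf, hb]⟩ hdeg

lemma tendsto_accompanyingExponent_succ_sub (hν : ν (Set.Iio 0) = 0)
    (hpos : ν (Set.Ioi 0) ≠ 0) (hf : IsCharFun f) (hh : IsCharFun h) (ha : ∀ n, 0 < a n)
    (hlim : ∀ t, Tendsto (fun n => laplaceTransform ν (accompanyingExponent h a μ n t)) atTop
      (𝓝 (f t)))
    (hdeg : ¬ ∃ b : ℝ, ∀ t : ℝ, f t = laplaceTransform ν (Complex.I * b * t)) (t : ℝ) :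
    Tendsto (fun n => accompanyingExponent h a μ (n + 1) t - accompanyingExponent h a μ n t) atTop
      (𝓝 0) := by
  have hE := isEquicontinuousExponents_accompanyingExponent (ν := ν) hν hpos hf hh hlim
  have hL := hE.isLevyExponent
  -- Along any ultrafilter finer than `atTop` both `ψ_n` and `ψ_{n+1}` have limits, and it is enough
  -- that these agree.
  rw [tendsto_iff_ultrafilter]
  intro U hU
  obtain ⟨Ψ, hΨ, hΨlim⟩ := hE.exists_tendsto U
  obtain ⟨Ψ', hΨ', hΨ'lim⟩ := (hE.comp (· + 1)).exists_tendsto U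
  have hU1 : Tendsto (fun n => n + 1) (U : Filter ℕ) atTop := (tendsto_add_atTop_nat 1).mono_left hU
  have hfΨ := laplaceTransform_eq_of_tendsto hν hL hlim (p := fun n => n) hU hΨlim
  have hfΨ' := laplaceTransform_eq_of_tendsto hν hL hlim hU1 hΨ'lim
  have hn0 : ∀ᶠ n in (U : Filter ℕ), n ≠ 0 := (eventually_ne_atTop 0).filter_mono hU
  have hq1 : Tendsto (fun n : ℕ => ((n + 1 : ℕ) : ℝ) / n) U (𝓝 1) := by
    refine Tendsto.mono_left ?_ hU
    have h1 : Tendsto (fun n : ℕ => 1 + 1 / (n : ℝ)) atTop (𝓝 1) := by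
      simpa using tendsto_one_div_atTop_nhds_zero_nat.const_add (1 : ℝ)
    refine h1.congr' ?_
    filter_upwards [eventually_ne_atTop 0] with n hn
    have : (n : ℝ) ≠ 0 := by exact_mod_cast hn
    push_cast
    field_simp
  have hq2 : Tendsto (fun n : ℕ => (n : ℝ) / ((n + 1 : ℕ) : ℝ)) U (𝓝 1) := by
    simpa using hq1.inv₀ one_ne_zero
  have heq : Ψ' t = Ψ t := by
    obtain ⟨c, hc0, hc1, hc | hc⟩ := exists_tendsto_div ha U (fun n => n) (fun n => n + 1)
    · obtain ⟨D, -, hD⟩ := eq_of_tendsto_accompanyingExponent ha hn0 hE hΨlim hΨ'lim hq1 hc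
      exact eq_of_eq_comp_mul_add hν hpos hdeg hΨ hfΨ hfΨ' hc0 hc1 (by simpa using hD) t
    · obtain ⟨D, -, hD⟩ := eq_of_tendsto_accompanyingExponent ha
        (.of_forall fun n => Nat.succ_ne_zero n) hE hΨ'lim hΨlim hq2 hc
      exact (eq_of_eq_comp_mul_add hν hpos hdeg hΨ' hfΨ' hfΨ hc0 hc1 (by simpa using hD) t).symm
  simpa [heq] using (hΨ'lim t).sub (hΨlim t)

/-- A nondegenerate limit of `φ (n (1 - h (t / a n)) + i t μ n)` is `φ` composed with a stable
exponent. -/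
lemma exists_stable_exponent (hν : ν (Set.Iio 0) = 0)
    (hpos : ν (Set.Ioi 0) ≠ 0) (hf : IsCharFun f) (hh : IsCharFun h) (ha : ∀ n, 0 < a n)
    (hlim : ∀ t, Tendsto (fun n => laplaceTransform ν (accompanyingExponent h a μ n t)) atTop
      (𝓝 (f t)))
    (hdeg : ¬ ∃ b : ℝ, ∀ t : ℝ, f t = laplaceTransform ν (Complex.I * b * t)) :
    ∃ Ψ : ℝ → ℂ, IsLevyExponent Ψ ∧ (∀ t, f t = laplaceTransform ν (Ψ t)) ∧
      ∀ N : ℕ, 1 ≤ N → ∃ c : ℝ, 0 < c ∧ ∃ D : ℝ, ((∀ n, μ n = 0) → D = 0) ∧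
        ∀ t : ℝ, N * Ψ t = Ψ (c * t) + Complex.I * D * t := by
  have hE := isEquicontinuousExponents_accompanyingExponent (ν := ν) hν hpos hf hh hlim
  have hL := hE.isLevyExponent
  have hconv : ∀ t, ∃ l, Tendsto (fun n => accompanyingExponent h a μ n t) atTop (𝓝 l) := by
    intro t
    obtain ⟨B, hB⟩ := hE.bounded |t|
    refine exists_tendsto_of_tendsto_comp (continuousOn_laplaceTransform hν)
      (differentiableOn_laplaceTransform hν) ?_ (fun n => (hL n).re_nonneg t)
      (fun n => hB n t le_rfl)
      (tendsto_accompanyingExponent_succ_sub hν hpos hf hh ha hlim hdeg t) (hlim t)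
    -- `φ` is not constant: it already separates `1` from `2`.
    by_contra! hcon
    have h1 := hcon ((1 : ℝ) : ℂ) (by simp)
    have h2 := hcon ((2 : ℝ) : ℂ) (by simp)
    rw [← h2, laplaceTransform_ofReal, laplaceTransform_ofReal, Complex.ofReal_inj] at h1
    have := integral_exp_neg_mul_inj hν hpos zero_le_one zero_le_two h1
    norm_num at this
  choose Ψ hΨ using hconv
  let U : Ultrafilter ℕ := Ultrafilter.of atTop
  have hU : (U : Filter ℕ) ≤ atTop := Ultrafilter.of_le _
  have hΨL : IsLevyExponent Ψ := by
    obtain ⟨Ψ₁, h1, h2⟩ := hE.exists_tendsto U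
    have : Ψ₁ = Ψ := funext fun t => tendsto_nhds_unique (h2 t) ((hΨ t).mono_left hU)
    rwa [← this]
  have hfΨ := laplaceTransform_eq_of_tendsto hν hL hlim (p := fun n => n) tendsto_id hΨ
  refine ⟨Ψ, hΨL, hfΨ, fun N hN => ?_⟩
  have hN0 : (N : ℝ) ≠ 0 := by
    have : N ≠ 0 := by omega
    exact_mod_cast this
  have hn0 : ∀ᶠ n in (U : Filter ℕ), n ≠ 0 := (eventually_ne_atTop 0).filter_mono hU
  have hNn : Tendsto (fun n : ℕ => N * n) (U : Filter ℕ) atTop :=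
    (tendsto_id.const_mul_atTop' hN).mono_left hU
  have hΨU : ∀ t, Tendsto (fun n => accompanyingExponent h a μ n t) U (𝓝 (Ψ t)) := fun t =>
    (hΨ t).mono_left hU
  have hΨN : ∀ t, Tendsto (fun n => accompanyingExponent h a μ (N * n) t) U (𝓝 (Ψ t)) := fun t =>
    (hΨ t).comp hNn
  have hq1 : Tendsto (fun n : ℕ => ((N * n : ℕ) : ℝ) / n) U (𝓝 N) := by
    refine tendsto_const_nhds.congr' ?_
    filter_upwards [hn0] with n hn
    have : (n : ℝ) ≠ 0 := by exact_mod_cast hn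
    push_cast
    field_simp
  have hq2 : Tendsto (fun n : ℕ => (n : ℝ) / ((N * n : ℕ) : ℝ)) U (𝓝 (N : ℝ)⁻¹) := by
    simpa using hq1.inv₀ hN0
  have hN0' : (N : ℂ) ≠ 0 := by exact_mod_cast hN0
  -- Only one of the two ratios of normings is known to be bounded, so the type relation may come
  -- out in either direction. The first is inverted, which is possible because `c = 0` would make
  -- `f` degenerate.
  obtain ⟨c, hc0, hc1, hc | hc⟩ := exists_tendsto_div ha U (fun n => n) (fun n => N * n)
  · obtain ⟨D, hD0, hD⟩ := eq_of_tendsto_accompanyingExponent ha hn0 hE hΨU hΨN hq1 hc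
    rcases hc0.eq_or_lt with rfl | hc0
    · refine absurd ⟨D, fun t => ?_⟩ hdeg
      rw [hfΨ, hD, zero_mul, hΨL.map_zero, mul_zero, zero_add]
    · refine ⟨c⁻¹, inv_pos.2 hc0, -(c⁻¹ * D), fun hμ => by simp [hD0 hμ], fun t => ?_⟩
      have := hD (c⁻¹ * t)
      rw [mul_inv_cancel_left₀ hc0.ne'] at this
      rw [this]
      push_cast
      ring
  · have hne : ∀ᶠ n in (U : Filter ℕ), N * n ≠ 0 := hn0.mono fun n hn =>
      Nat.mul_ne_zero (by omega) hn
    obtain ⟨D, hD0, hD⟩ := eq_of_tendsto_accompanyingExponent ha hne hE hΨN hΨU hq2 hc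
    rcases hc0.eq_or_lt with rfl | hc0
    · refine absurd ⟨D, fun t => ?_⟩ hdeg
      rw [hfΨ, hD, zero_mul, hΨL.map_zero, mul_zero, zero_add]
    · refine ⟨c, hc0, N * D, fun hμ => by simp [hD0 hμ], fun t => ?_⟩
      rw [hD t]
      push_cast
      field_simp

/-- A drift is strictly stable with norming `c = n`. This disposes of every `f` to which rigidity
does not apply. -/
lemma isPhiStrictlyStable_of_eq_I_mul {φ : ℂ → ℂ} {b : ℝ}
    (h : ∀ t : ℝ, f t = φ (Complex.I * b * t)) : IsPhiStrictlyStable φ f := by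
  refine ⟨fun t => Complex.exp (-(Complex.I * b * t)), fun t => Complex.I * b * t,
    ⟨(IsLevyExponent.I_mul b).isCharFun_one, fun n hn => ⟨n, by exact_mod_cast hn, fun t => ?_⟩⟩,
    (IsLevyExponent.I_mul b).isNegLog, h⟩
  rw [← Complex.exp_nat_mul]
  congr 1
  push_cast
  ring

lemma IsPhiStrictlyStable.isPhiStable {φ : ℂ → ℂ} (h : IsPhiStrictlyStable φ f) :
    IsPhiStable φ f := by
  obtain ⟨ω, ψ, ⟨hω, hs⟩, hψ, hf⟩ := h
  refine ⟨ω, ψ, ⟨hω, fun n hn => ?_⟩, hψ, hf⟩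
  obtain ⟨c, hc, h⟩ := hs n hn
  exact ⟨c, hc, 0, fun t => by simpa using h t⟩

lemma exists_eq_I_mul_of_measure_Ioi (hν : ν (Set.Iio 0) = 0) (h0 : ν (Set.Ioi 0) = 0)
    {ψ : ℕ → ℝ → ℂ} (hlim : ∀ t, Tendsto (fun n => laplaceTransform ν (ψ n t)) atTop (𝓝 (f t))) :
    ∃ b : ℝ, ∀ t : ℝ, f t = laplaceTransform ν (Complex.I * b * t) := by
  refine ⟨0, fun t => ?_⟩
  have := hlim t
  simp_rw [laplaceTransform_eq_one_of_measure_Ioi hν h0] at this ⊢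
  exact tendsto_nhds_unique this tendsto_const_nhds

theorem isPhiStable_of_tendsto (hν : ν (Set.Iio 0) = 0) (hf : IsCharFun f) (hh : IsCharFun h)
    (ha : ∀ n, 0 < a n)
    (hlim : ∀ t, Tendsto (fun n => laplaceTransform ν (accompanyingExponent h a μ n t)) atTop
      (𝓝 (f t))) : IsPhiStable (laplaceTransform ν) f := by
  by_cases hdeg : ∃ b : ℝ, ∀ t : ℝ, f t = laplaceTransform ν (Complex.I * b * t)
  · obtain ⟨b, hb⟩ := hdeg
    exact (isPhiStrictlyStable_of_eq_I_mul hb).isPhiStable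
  have hpos : ν (Set.Ioi 0) ≠ 0 := fun h0 => hdeg (exists_eq_I_mul_of_measure_Ioi hν h0 hlim)
  obtain ⟨Ψ, hΨ, hfΨ, hs⟩ := exists_stable_exponent hν hpos hf hh ha hlim hdeg
  refine ⟨_, Ψ, ⟨hΨ.isCharFun_one, fun n hn => ?_⟩, hΨ.isNegLog, hfΨ⟩
  obtain ⟨c, hc, D, -, h⟩ := hs n hn
  refine ⟨c, hc, -D, fun t => ?_⟩
  rw [← Complex.exp_nat_mul, ← Complex.exp_add, mul_neg, h]
  congr 1
  push_cast
  ring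

theorem isPhiStrictlyStable_of_tendsto (hν : ν (Set.Iio 0) = 0) (hf : IsCharFun f)
    (hh : IsCharFun h) (ha : ∀ n, 0 < a n) (hμ : ∀ n, μ n = 0)
    (hlim : ∀ t, Tendsto (fun n => laplaceTransform ν (accompanyingExponent h a μ n t)) atTop
      (𝓝 (f t))) : IsPhiStrictlyStable (laplaceTransform ν) f := by
  by_cases hdeg : ∃ b : ℝ, ∀ t : ℝ, f t = laplaceTransform ν (Complex.I * b * t)
  · obtain ⟨b, hb⟩ := hdeg
    exact isPhiStrictlyStable_of_eq_I_mul hb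
  have hpos : ν (Set.Ioi 0) ≠ 0 := fun h0 => hdeg (exists_eq_I_mul_of_measure_Ioi hν h0 hlim)
  obtain ⟨Ψ, hΨ, hfΨ, hs⟩ := exists_stable_exponent hν hpos hf hh ha hlim hdeg
  refine ⟨_, Ψ, ⟨hΨ.isCharFun_one, fun n hn => ?_⟩, hΨ.isNegLog, hfΨ⟩
  obtain ⟨c, hc, D, hD, h⟩ := hs n hn
  refine ⟨c, hc, fun t => ?_⟩
  rw [← Complex.exp_nat_mul, mul_neg, h, hD hμ]
  simp

end Representation

/-! ### From stability to the limit. -/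

namespace IsNegLog

variable {ψ ω : ℝ → ℂ}

lemma re_nonneg (h : IsNegLog ψ ω) (hω : IsCharFun ω) (t : ℝ) : 0 ≤ (ψ t).re := by
  have h1 := hω.norm_le_one t
  rw [← h.2.2 t, Complex.norm_exp, Real.exp_le_one_iff] at h1
  simpa using h1

lemma mul_eq_of_pow_eq (h : IsNegLog ψ ω) {n : ℕ} {c d : ℝ}
    (hs : ∀ t : ℝ, ω t ^ n = ω (c * t) * Complex.exp (Complex.I * (d : ℂ) * (t : ℂ))) (t : ℝ) :
    n * ψ t = ψ (c * t) - Complex.I * d * t := by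
  have hc := h.1
  have := eq_of_exp_eq (u := fun t => n * -ψ t) (v := fun t : ℝ => -ψ (c * t) + Complex.I * d * t)
    (by fun_prop) (by fun_prop) (by simp [h.2.1])
    (fun t => by rw [Complex.exp_nat_mul, Complex.exp_add, h.2.2, h.2.2, hs]) t
  linear_combination -this

/-- A characteristic function of modulus one is that of a degenerate law. -/
lemma eq_I_mul_of_re_eq_zero (h : IsNegLog ψ ω) (hω : IsCharFun ω) (h0 : ∀ t, (ψ t).re = 0) :
    ∃ b : ℝ, ∀ t : ℝ, ψ t = Complex.I * b * t := by
  have hψI : ∀ t, ψ t = Complex.I * (ψ t).im := fun t => by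
    apply Complex.ext <;> simp [h0]
  have hψc := h.1
  have hadd : ∀ s t, ψ (s + t) = ψ s + ψ t := by
    intro s t
    rcases eq_or_ne s 0 with rfl | hs
    · simp [h.2.1]
    -- Shifting by `b` makes the characteristic function equal to `1` at `s`; the increment
    -- inequality then makes it `s`-periodic.
    set b : ℝ := (ψ s).im / s with hb
    have hbs : ψ s = Complex.I * b * s := by
      rw [hψI s, hb]
      have : (s : ℂ) ≠ 0 := by exact_mod_cast hs
      push_cast
      field_simp
    have hω' := hω.mul (IsCharFun.exp_I_mul b)
    have h1 : ω s * Complex.exp (Complex.I * b * s) = 1 := by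
      rw [← h.2.2, ← Complex.exp_add, ← hbs]
      simp
    refine eq_of_exp_eq (u := fun t => ψ (s + t)) (v := fun t => ψ s + ψ t) (by fun_prop)
      (by fun_prop) (by simp [h.2.1]) (fun t => ?_) t
    have h2 := hω'.norm_add_sub_sub_sq_le s t
    simp only [h1, sub_self, Complex.zero_re, zero_mul, mul_zero, sub_zero] at h2
    have h3 := norm_eq_zero.1 (pow_eq_zero_iff two_ne_zero |>.1 (le_antisymm h2 (sq_nonneg _)))
    have h4 : Complex.exp (-ψ (s + t)) * Complex.exp (ψ s) = Complex.exp (-ψ t) := by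
      rw [h.2.2 (s + t), h.2.2 t, hbs]
      have h5 : Complex.exp (Complex.I * b * ((s + t : ℝ) : ℂ)) =
          Complex.exp (Complex.I * b * s) * Complex.exp (Complex.I * b * t) := by
        rw [← Complex.exp_add]
        congr 1
        push_cast
        ring
      rw [h5] at h3
      have h6 : (ω t - ω (s + t) * Complex.exp (Complex.I * b * s)) *
          Complex.exp (Complex.I * b * t) = 0 := by
        linear_combination h3
      exact (sub_eq_zero.1 ((mul_eq_zero.1 h6).resolve_right (Complex.exp_ne_zero _))).symm
    rw [Complex.exp_neg, Complex.exp_neg] at h4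
    rw [Complex.exp_add]
    have := Complex.exp_ne_zero (ψ (s + t))
    have := Complex.exp_ne_zero (ψ t)
    field_simp at h4
    rw [← h4]
  let A : ℝ →+ ℂ := AddMonoidHom.mk' ψ hadd
  refine ⟨(ψ 1).im, fun t => ?_⟩
  have := map_real_smul A hψc t 1
  simp only [A, AddMonoidHom.mk'_apply, smul_eq_mul, mul_one] at this
  rw [this, hψI 1, Complex.real_smul]
  simp
  ring

end IsNegLog

lemma tendsto_nat_mul_one_sub_exp_neg_sub {w : ℕ → ℂ}
    (hw : Tendsto (fun n => n * ‖w n‖ ^ 2) atTop (𝓝 0)) :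
    Tendsto (fun n : ℕ => (n : ℂ) * (1 - Complex.exp (-w n)) - n * w n) atTop (𝓝 0) := by
  refine squeeze_zero_norm' ?_ hw
  filter_upwards [hw.eventually (gt_mem_nhds one_pos), eventually_ge_atTop 1] with n hn hn1
  have hn1' : (1 : ℝ) ≤ n := by exact_mod_cast hn1
  have h1 : ‖-w n‖ ≤ 1 := by
    rw [norm_neg]
    by_contra! hlt
    nlinarith
  have h2 := Complex.norm_exp_sub_one_sub_id_le h1
  have h3 : (n : ℂ) * (1 - Complex.exp (-w n)) - n * w n =
      -(n * (Complex.exp (-w n) - 1 - -w n)) := by ring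
  rw [h3, norm_neg, norm_mul, Complex.norm_natCast]
  rw [norm_neg] at h2
  gcongr

section Forward

variable {ν : Measure ℝ} [IsProbabilityMeasure ν]

lemma tendsto_laplaceTransform_accompanyingExponent (hν : ν (Set.Iio 0) = 0) {ψ ψ₀ : ℝ → ℂ}
    (hh : IsCharFun fun t => Complex.exp (-ψ₀ t)) {a μ : ℕ → ℝ} {t : ℝ} (hψ : 0 ≤ (ψ t).re)
    (heq : ∀ n : ℕ, 1 ≤ n → ψ t = n * ψ₀ (t / a n) + Complex.I * t * μ n)
    (hsmall : Tendsto (fun n : ℕ => n * ‖ψ₀ (t / a n)‖ ^ 2) atTop (𝓝 0)) :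
    Tendsto (fun n => laplaceTransform ν
      (accompanyingExponent (fun t => Complex.exp (-ψ₀ t)) a μ n t)) atTop
      (𝓝 (laplaceTransform ν (ψ t))) := by
  refine (continuousOn_laplaceTransform hν _ hψ).tendsto.comp (tendsto_nhdsWithin_iff.2
    ⟨?_, .of_forall fun n => (isLevyExponent_accompanyingExponent hh a μ n).re_nonneg t⟩)
  have h1 := (tendsto_nat_mul_one_sub_exp_neg_sub hsmall).add_const (ψ t)
  rw [zero_add] at h1
  refine h1.congr' ?_
  filter_upwards [eventually_ge_atTop 1] with n hn
  simp only [accompanyingExponent]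
  rw [heq n hn]
  ring

theorem IsPhiStrictlyStable.exists_tendsto (hν : ν (Set.Iio 0) = 0) {f : ℝ → ℂ}
    (h : IsPhiStrictlyStable (laplaceTransform ν) f) :
    ∃ (a : ℕ → ℝ) (h : ℝ → ℂ), (∀ n, 0 < a n) ∧ IsCharFun h ∧
      ∀ t, Tendsto (fun n => laplaceTransform ν (accompanyingExponent h a (fun _ => 0) n t)) atTop
        (𝓝 (f t)) := by
  obtain ⟨ω, ψ, ⟨hω, hs⟩, hψ, hf⟩ := h
  choose! c hc hcω using hs
  have hωψ : ω = fun t => Complex.exp (-ψ t) := funext fun t => (hψ.2.2 t).symm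
  -- Stability says nothing at `n = 0`; any positive value serves there.
  let a : ℕ → ℝ := fun n => if 1 ≤ n then c n else 1
  have ha : ∀ n, 0 < a n := fun n => by
    by_cases hn : 1 ≤ n
    · simpa [a, hn] using hc n hn
    · simp [a, hn]
  have heq : ∀ n : ℕ, 1 ≤ n → ∀ t, ψ t = n * ψ (t / a n) := by
    intro n hn t
    have han : a n = c n := if_pos hn
    have h1 := hψ.mul_eq_of_pow_eq (n := n) (c := c n) (d := 0) (by simpa using hcω n hn) (t / a n)
    rw [← han, mul_div_cancel₀ _ (ha n).ne'] at h1
    simpa using h1.symm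
  refine ⟨a, fun t => Complex.exp (-ψ t), ha, hωψ ▸ hω, fun t => ?_⟩
  rw [hf t]
  refine tendsto_laplaceTransform_accompanyingExponent hν (hωψ ▸ hω) (hψ.re_nonneg hω t)
    (fun n hn => by simpa using heq n hn t) ?_
  have h1 : Tendsto (fun n : ℕ => ‖ψ t‖ ^ 2 / (n : ℝ)) atTop (𝓝 0) :=
    tendsto_const_div_atTop_nhds_zero_nat _
  refine h1.congr' ?_
  filter_upwards [eventually_ge_atTop 1] with n hn
  have hn0 : (n : ℝ) ≠ 0 := by
    have : n ≠ 0 := by omega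
    exact_mod_cast this
  conv_lhs => rw [heq n hn t, norm_mul, Complex.norm_natCast]
  field_simp

/-- If `x ≤ 1`, the points `x ^ k * t₀` stay in a compact interval while `g` grows like `y ^ k` on
them. -/
lemma one_lt_of_comp_mul_eq {g : ℝ → ℝ} (hg : Continuous g) {t₀ x y : ℝ} (h0 : 0 < g t₀)
    (hx : 0 < x) (hy : 1 < y) (h : ∀ t, g (x * t) = y * g t) : 1 < x := by
  by_contra! hx1
  obtain ⟨B, hB⟩ := (isCompact_Icc (a := -|t₀|) (b := |t₀|)).bddAbove_image hg.continuousOn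
  have hiter : ∀ k : ℕ, g (x ^ k * t₀) = y ^ k * g t₀ := by
    intro k
    induction k with
    | zero => simp
    | succ k ih => rw [pow_succ', mul_assoc, h, ih, pow_succ']; ring
  obtain ⟨k, hk⟩ := pow_unbounded_of_one_lt (B / g t₀) hy
  rw [div_lt_iff₀ h0, ← hiter] at hk
  refine absurd (hB ⟨x ^ k * t₀, ?_, rfl⟩) (not_le.2 hk)
  rw [Set.mem_Icc, ← abs_le, abs_mul, abs_of_pos (pow_pos hx k)]
  exact mul_le_of_le_one_left (abs_nonneg _) (pow_le_one₀ hx.le hx1)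

/-- A stable exponent can be centred so that the centring for the sum of two copies is zero unless
the norming is `2`. -/
lemma exists_centering {ψ : ℝ → ℂ} {c d : ℝ}
    (h : ∀ t : ℝ, 2 * ψ t = ψ (c * t) - Complex.I * d * t) :
    ∃ b e : ℝ, (c = 2 ∨ e = 0) ∧ ∀ t : ℝ, ψ (c * t) - Complex.I * b * (c * t : ℝ) =
      2 * (ψ t - Complex.I * b * t) + Complex.I * e * t := by
  by_cases hc : c = 2
  · refine ⟨0, d, .inl hc, fun t => ?_⟩
    push_cast
    linear_combination -(h t)
  -- This shift absorbs the drift exactly. For `c = 2` shifting has no effect on the relation and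
  -- the drift stays.
  · refine ⟨d / (c - 2), 0, .inr rfl, fun t => ?_⟩
    have : (c : ℂ) - 2 ≠ 0 := by
      intro h0
      exact hc (by exact_mod_cast sub_eq_zero.1 h0)
    have h1 := h t
    push_cast
    field_simp
    linear_combination -(c - 2 : ℂ) * h1

/-- If `c = 2`, each halving contributes the same drift `e t / 2`, so the correction is linear in
`j`; otherwise there is none. Linear growth is harmless against `2 ^ j`. -/
lemma norm_comp_div_pow_le {ψ : ℝ → ℂ} {c e : ℝ} (hc : 0 < c) (hce : c = 2 ∨ e = 0)
    (h : ∀ t : ℝ, ψ (c * t) = 2 * ψ t + Complex.I * e * t) (j : ℕ) (t : ℝ) :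
    2 ^ j * ‖ψ (t / c ^ j)‖ ≤ ‖ψ t‖ + j * (|e| * |t|) := by
  have hid : ∀ j : ℕ, (2 : ℂ) ^ j * ψ (t / c ^ j) = ψ t - j * (Complex.I * e * t / 2) := by
    intro j
    induction j with
    | zero => simp
    | succ j ih =>
      have h1 := h (t / c ^ (j + 1))
      have h2 : c * (t / c ^ (j + 1)) = t / c ^ j := by
        rw [pow_succ]
        field_simp
      rw [h2] at h1
      rw [h1] at ih
      have h3 : (2 : ℂ) ^ j * (Complex.I * e * (t / c ^ (j + 1) : ℝ)) = Complex.I * e * t / 2 := by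
        rcases hce with rfl | rfl
        · push_cast
          rw [pow_succ]
          field_simp
        · simp
      rw [pow_succ]
      push_cast
      linear_combination ih - h3
  have h1 := congrArg norm (hid j)
  rw [norm_mul, norm_pow, Complex.norm_ofNat] at h1
  rw [h1]
  refine (norm_sub_le _ _).trans ?_
  gcongr
  rw [norm_mul, Complex.norm_natCast]
  gcongr
  simp only [norm_div, norm_mul, Complex.norm_I, Complex.norm_real, Real.norm_eq_abs, one_mul,
    Complex.norm_ofNat]
  have : 0 ≤ |e| * |t| := by positivity
  linarith

lemma tendsto_sq_div_two_pow (M K : ℝ) :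
    Tendsto (fun j : ℕ => 2 * ((M + j * K) ^ 2 / 2 ^ j)) atTop (𝓝 0) := by
  have h := fun k => tendsto_pow_const_div_const_pow_of_one_lt k (one_lt_two (α := ℝ))
  have h1 := (((h 0).const_mul (M ^ 2)).add ((h 1).const_mul (2 * M * K))).add
    ((h 2).const_mul (K ^ 2))
  have h2 := h1.const_mul 2
  simp only [mul_zero, add_zero] at h2
  refine h2.congr fun j => ?_
  ring

theorem IsPhiStable.exists_tendsto (hν : ν (Set.Iio 0) = 0) {f : ℝ → ℂ}
    (h : IsPhiStable (laplaceTransform ν) f) :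
    ∃ (a μ : ℕ → ℝ) (h : ℝ → ℂ), (∀ n, 0 < a n) ∧ IsCharFun h ∧
      ∀ t, Tendsto (fun n => laplaceTransform ν (accompanyingExponent h a μ n t)) atTop
        (𝓝 (f t)) := by
  obtain ⟨ω, ψ, ⟨hω, hs⟩, hψ, hf⟩ := h
  have hψc := hψ.1
  by_cases hdeg : ∀ t, (ψ t).re = 0
  · obtain ⟨b, hb⟩ := hψ.eq_I_mul_of_re_eq_zero hω hdeg
    refine ⟨fun _ => 1, fun _ => b, fun _ => 1, fun _ => one_pos, IsCharFun.one, fun t => ?_⟩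
    refine tendsto_const_nhds.congr fun n => ?_
    rw [hf, hb]
    simp only [accompanyingExponent]
    congr 1
    ring
  push Not at hdeg
  obtain ⟨t₀, ht₀⟩ := hdeg
  have ht₀ : 0 < (ψ t₀).re := lt_of_le_of_ne (hψ.re_nonneg hω t₀) ht₀.symm
  choose! c hc d hcd using hs
  have hlog : ∀ n : ℕ, 1 ≤ n → ∀ t : ℝ, n * ψ t = ψ (c n * t) - Complex.I * d n * t :=
    fun n hn => hψ.mul_eq_of_pow_eq (hcd n hn)
  have hg : ∀ n : ℕ, 1 ≤ n → ∀ t : ℝ, (ψ (c n * t)).re = n * (ψ t).re := by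
    intro n hn t
    have := congrArg Complex.re (hlog n hn t)
    simpa using this.symm
  have hgc : Continuous fun t => (ψ t).re := by fun_prop
  set C := c 2 with hC
  have hC0 : 0 < C := hc 2 one_le_two
  have hg2 : ∀ t, (ψ (C * t)).re = 2 * (ψ t).re := by simpa using hg 2 one_le_two
  have hgpow : ∀ (j : ℕ) (t : ℝ), (ψ t).re = 2 ^ j * (ψ (t / C ^ j)).re := by
    intro j t
    induction j with
    | zero => simp
    | succ j ih =>
      have h1 := hg2 (t / C ^ (j + 1))
      have h2 : C * (t / C ^ (j + 1)) = t / C ^ j := by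
        rw [pow_succ]
        field_simp
      rw [h2] at h1
      rw [ih, h1, pow_succ]
      ring
  -- The scaling `c n * C / C ^ j` multiplies `Re ψ` by `2n / 2 ^ j`. The spare factor `C`, with its
  -- `2`, makes this exceed `1` strictly.
  have hcn : ∀ n j : ℕ, 1 ≤ n → 2 ^ j ≤ n → C ^ j < C * c n := by
    intro n j hn hj
    have hj' : (2 : ℝ) ^ j ≤ n := by exact_mod_cast hj
    have h1 : 1 < c n * C / C ^ j := by
      refine one_lt_of_comp_mul_eq hgc (y := n * 2 / 2 ^ j) ht₀ (by have := hc n hn; positivity) ?_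
        fun t => ?_
      · rw [one_lt_div (by positivity)]
        have : (0 : ℝ) < 2 ^ j := by positivity
        linarith
      · have h2 : c n * C / C ^ j * t = c n * (C * (t / C ^ j)) := by ring
        rw [h2, hg n hn, hg2, hgpow j t]
        field_simp
    rw [one_lt_div (by positivity)] at h1
    linarith
  obtain ⟨b, e, hCe, hcen⟩ := exists_centering (c := C) (d := d 2) (ψ := ψ) (by
    simpa using hlog 2 one_le_two)
  let ψ₀ : ℝ → ℂ := fun t => ψ t - Complex.I * b * t
  have hψ₀c : Continuous ψ₀ := by fun_prop
  have hh : IsCharFun fun t => Complex.exp (-ψ₀ t) := by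
    convert! hω.mul (IsCharFun.exp_I_mul b) using 2 with t
    rw [← hψ.2.2, ← Complex.exp_add]
    congr 1
    simp only [ψ₀]
    ring
  let a : ℕ → ℝ := fun n => if 1 ≤ n then c n else 1
  have han : ∀ n, 1 ≤ n → a n = c n := fun n hn => if_pos hn
  have ha : ∀ n, 0 < a n := fun n => by
    by_cases hn : 1 ≤ n
    · rw [han n hn]
      exact hc n hn
    · simp [a, hn]
  -- The centring collects the drift `d n` of the stability relation and the `n` shifts by `b`.
  refine ⟨a, fun n => (b * n + d n) / a n, fun t => Complex.exp (-ψ₀ t), ha, hh, fun t => ?_⟩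
  rw [hf t]
  refine tendsto_laplaceTransform_accompanyingExponent hν hh (hψ.re_nonneg hω t)
    (fun n hn => ?_) ?_
  · have h1 := hlog n hn (t / a n)
    rw [← han n hn, mul_div_cancel₀ _ (ha n).ne'] at h1
    simp only [ψ₀]
    push_cast at h1 ⊢
    linear_combination -h1
  · obtain ⟨M, hM⟩ := (isCompact_Icc (a := -(C * |t|)) (b := C * |t|)).exists_bound_of_continuousOn
      hψ₀c.continuousOn
    have hlim := (tendsto_sq_div_two_pow M (|e| * (C * |t|))).comp
      (tendsto_atTop_atTop_of_monotone (Nat.log_monotone (b := 2)) fun k =>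
        ⟨2 ^ k, (Nat.log_pow one_lt_two k).ge⟩)
    refine squeeze_zero' (.of_forall fun n => by positivity) ?_ hlim
    filter_upwards [eventually_ge_atTop 1] with n hn
    set j := Nat.log 2 n with hj
    have hjn : 2 ^ j ≤ n := Nat.pow_log_le_self 2 (by omega)
    have hnj : n < 2 ^ (j + 1) := Nat.lt_pow_succ_log_self one_lt_two n
    have hnj' : (n : ℝ) ≤ 2 * 2 ^ j := by
      have : n ≤ 2 * 2 ^ j := by rw [← pow_succ']; exact hnj.le
      exact_mod_cast this
    -- With `2 ^ j ≤ n < 2 ^ (j + 1)`, the bound `hcn` keeps `s` in a fixed compact interval, so the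
    -- estimate along powers of `C` applies at `s` uniformly in `n`.
    set s := t * C ^ j / a n with hs
    have hst : t / a n = s / C ^ j := by
      rw [hs]
      field_simp
    have hsabs : |s| ≤ C * |t| := by
      rw [hs, abs_div, abs_mul, abs_of_pos (ha n), abs_of_pos (pow_pos hC0 j), div_le_iff₀ (ha n),
        han n hn]
      have := (hcn n j hn hjn).le
      nlinarith [abs_nonneg t]
    have h1 := norm_comp_div_pow_le (ψ := ψ₀) hC0 hCe hcen j s
    have h2 : 2 ^ j * ‖ψ₀ (s / C ^ j)‖ ≤ M + j * (|e| * (C * |t|)) := by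
      refine h1.trans ?_
      gcongr
      exact hM s (Set.mem_Icc.2 (abs_le.1 hsabs))
    rw [hst]
    have h3 : (2 ^ j * ‖ψ₀ (s / C ^ j)‖) ^ 2 ≤ (M + j * (|e| * (C * |t|))) ^ 2 := by
      gcongr
    simp only [Function.comp_apply]
    calc (n : ℝ) * ‖ψ₀ (s / C ^ j)‖ ^ 2 ≤ 2 * 2 ^ j * ‖ψ₀ (s / C ^ j)‖ ^ 2 := by gcongr
      _ = 2 * ((2 ^ j * ‖ψ₀ (s / C ^ j)‖) ^ 2 / 2 ^ j) := by field_simp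
      _ ≤ _ := by gcongr

end Forward

theorem theorem2p6 (ν : Measure ℝ) [IsProbabilityMeasure ν] (hν : ν (Set.Iio 0) = 0)
    (f : ℝ → ℂ) (hf : IsCharFun f) :
    (IsPhiStable (laplaceTransform ν) f ↔
      ∃ (a μ : ℕ → ℝ) (h : ℝ → ℂ), (∀ n, 0 < a n) ∧ IsCharFun h ∧
        ∀ t : ℝ, Tendsto
          (fun n : ℕ => laplaceTransform ν
            ((n : ℂ) * (1 - h (t / a n)) + Complex.I * (t : ℂ) * (μ n : ℂ)))
          atTop (𝓝 (f t))) ∧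
    (IsPhiStrictlyStable (laplaceTransform ν) f ↔
      ∃ (a : ℕ → ℝ) (h : ℝ → ℂ), (∀ n, 0 < a n) ∧ IsCharFun h ∧
        ∀ t : ℝ, Tendsto
          (fun n : ℕ => laplaceTransform ν ((n : ℂ) * (1 - h (t / a n))))
          atTop (𝓝 (f t))) := by
  refine ⟨⟨fun h => h.exists_tendsto hν, ?_⟩, ⟨fun h => ?_, ?_⟩⟩
  · rintro ⟨a, μ, h, ha, hh, hlim⟩
    exact isPhiStable_of_tendsto hν hf hh ha hlim
  · obtain ⟨a, h, ha, hh, hlim⟩ := h.exists_tendsto hν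
    exact ⟨a, h, ha, hh, by simpa [accompanyingExponent] using hlim⟩
  · rintro ⟨a, h, ha, hh, hlim⟩
    refine isPhiStrictlyStable_of_tendsto (μ := fun _ => 0) hν hf hh ha (fun _ => rfl) ?_
    simpa [accompanyingExponent] using hlim
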